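/- Let $G$ be a finite simple graph on $n$ vertices. Starting from a set $S\subseteq V(G)$ of blue vertices, all other vertices being white, apply the rule ``if a blue vertex has exactly one white neighbor, that neighbor becomes blue'' repeatedly; $S$ is a zero forcing set if eventually all vertices are blue. The zero forcing span $\lambda(G)$ is the number of integers $k$ for which there are sets $Z,F\subseteq V(G)$ with $|Z|=|F|=k$ such that $Z$ is a zero forcing set and $F$ is not. Let $P_k$ be the path on $k\ge 1$ vertices, $K_1$ the one-vertex graph, and $N(v)$ the set of neighbors of $v$ in $G$. A graph $G$ is a graph of two parallel paths if $G$ is not a path, and $V(G)$ can be partitioned into two nonempty sets $V_1,V_2$, each inducing a path, such that $G$ can be drawn in the plane with the two induced paths drawn as segments of two distinct parallel lines (a single point for $P_1$) and the edges between $V_1$ and $V_2$ drawn as straight line segments that do not cross. Such a drawing is called a standard drawing of $G$. Theorem. $\lambda(G)=n-3$ if and only if $G$ is one of the following graphs. \begin{enumerate} \item Two parallel paths with an additional $K_1$ component; that is, $G$ has an isolated vertex whose deletion leaves a graph of two parallel paths. \item $P_4$ or $P_5$. \item A graph of two parallel paths such that any standard drawing of it has one of the following forms (up to the choice of which of the two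 paths is named first, and the direction in which the paths are labelled). \begin{enumerate} \item The paths are $P_1=\{x\}$ and $P_k$ with $k\ge 3$, and \begin{enumerate} \item for some $u,v,w$ that form a subpath $uvw$ of $P_k$, $N(x)=\{u,w\}$ or $N(x)=\{u,v,w\}$; or \item for an end vertex $v$ of $P_k$ with neighbor $w$ on $P_k$, $N(x)=\{w\}$ or $N(x)=\{v,w\}$. \end{enumerate} \item The paths are $P_2=uv$ and $P_k$ with $N(u)\cap V(P_k)=N(v)\cap V(P_k)$, and if $k=1$ and $V(P_1)=\{x\}$, then $ux,vx\in E(G)$. \item The paths are $P_3=uvw$ and $P_k$, where $N(u)=N(w)=\{v\}$ or $N(u)=N(w)=\{v,x\}$ for some $x$ on $P_k$, and if $k=1$, then the vertex of $P_k$ is not isolated in $G$. \item The paths are $P_k=v_1v_2\cdots v_k$ and $P_j=w_1w_2\cdots w_j$ with $k,j\ge 2$, and the set of edges between $P_k$ and $P_j$ is one of $\{v_{k-1}w_1,\,v_kw_2\}$, $\{v_{k-1}w_1,\,v_kw_2,\,v_{k-1}w_2\}$, $\{v_{k-1}w_1,\,v_kw_2,\,v_kw_1\}$. \end{enumerate}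 \end{enumerate} -/

import Mathlib

namespace ZeroForcingSpan

variable {V : Type*}

/-- One application of the standard color change rule: `B` is the set of blue vertices, some blue
vertex `u` has exactly one white neighbor `v`, and `v` becomes blue. -/
def ColorChange [DecidableEq V] (G : SimpleGraph V) (B B' : Finset V) : Prop :=
  ∃ u ∈ B, ∃ v, v ∉ B ∧ (∀ w, (G.Adj u w ∧ w ∉ B) ↔ w = v) ∧ B' = insert v B

/-- `S` is a zero forcing set: starting from the blue set `S`, repeated applications of the color
change rule turn every vertex blue. -/
def IsZeroForcing [Fintype V] [DecidableEq V] (G : SimpleGraph V) (S : Finset V) : Prop :=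
  Relation.ReflTransGen (ColorChange G) S Finset.univ

/-- The zero forcing span `λ(G)`: the number of cardinalities `k` for which there are both a zero
forcing set with `k` elements and a set with `k` elements that is not zero forcing. (All such `k`
are at most the order of `G`, so this is the cardinality of a finite set.) -/
noncomputable def span [Fintype V] [DecidableEq V] (G : SimpleGraph V) : ℕ :=
  {k : ℕ | ∃ Z F : Finset V, Z.card = k ∧ F.card = k ∧
    IsZeroForcing G Z ∧ ¬ IsZeroForcing G F}.ncard

/-- `G` is the path `P_n` on `n` vertices. -/
def IsPathOn (G : SimpleGraph V) (n : ℕ) : Prop :=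
  Nonempty (G ≃g SimpleGraph.pathGraph n)

/-- A standard drawing of `G`: the vertices are partitioned into two nonempty sets, the ranges of
`p` and `q`, each of which induces a path, namely `p 0, p 1, …` and `q 0, q 1, …`. The vertices are
placed in the plane, each of the two paths being drawn along its own line, the two lines being
parallel and distinct (common direction `d`, through `a` and `b` respectively). The vertices
of each path occur on its line in the order of the path; both paths are labelled in the direction
of `d`. Edges between the two paths are straight line segments, no two of which cross. -/
structure StandardDrawing (G : SimpleGraph V) where
  k : ℕ
  j : ℕ
  k_pos : 0 < k
  j_pos : 0 < j
  p : SimpleGraph.pathGraph k ↪g G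
  q : SimpleGraph.pathGraph j ↪g G
  partition : IsCompl (Set.range p) (Set.range q)
  pos : V → ℝ × ℝ
  a : ℝ × ℝ
  b : ℝ × ℝ
  d : ℝ × ℝ
  distinct_lines : LinearIndependent ℝ ![d, b - a]
  s : Fin k → ℝ
  t : Fin j → ℝ
  s_mono : StrictMono s
  t_mono : StrictMono t
  pos_p : ∀ i, pos (p i) = a + s i • d
  pos_q : ∀ i, pos (q i) = b + t i • d
  not_crossing : ∀ (i i' : Fin k) (l l' : Fin j), G.Adj (p i) (q l) → G.Adj (p i') (q l') →
    (i, l) ≠ (i', l') →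
    Disjoint (openSegment ℝ (pos (p i)) (pos (q l))) (openSegment ℝ (pos (p i')) (pos (q l')))

/-- `G` is a graph of two parallel paths. -/
def TwoParallelPaths (G : SimpleGraph V) : Prop :=
  (¬ ∃ n, IsPathOn G n) ∧ Nonempty (StandardDrawing G)

/-- The first path is `P_1 = {x}` and the second is `P_k` with `k ≥ 3`, and either
`N(x) = {u, w}` or `N(x) = {u, v, w}` for a subpath `uvw` of `P_k`, or `N(x) = {w}` or
`N(x) = {v, w}` for an end vertex `v` of `P_k` and its neighbor `w` on `P_k`. -/
def FormA (G : SimpleGraph V) (V₁ V₂ : Set V) : Prop :=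
  ∃ x, V₁ = {x} ∧ 3 ≤ V₂.ncard ∧
    ((∃ u ∈ V₂, ∃ v ∈ V₂, ∃ w ∈ V₂, u ≠ w ∧ G.Adj u v ∧ G.Adj v w ∧
        (G.neighborSet x = {u, w} ∨ G.neighborSet x = {u, v, w})) ∨
      (∃ v ∈ V₂, ∃ w ∈ V₂, G.neighborSet v ∩ V₂ = {w} ∧
        (G.neighborSet x = {w} ∨ G.neighborSet x = {v, w})))

/-- The first path is `P_2 = uv`, and `u`, `v` have the same neighbors on the second path; if the
second path is a single vertex `x`, then `ux` and `vx` are edges. -/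
def FormB (G : SimpleGraph V) (V₁ V₂ : Set V) : Prop :=
  ∃ u v, V₁ = {u, v} ∧ G.Adj u v ∧ G.neighborSet u ∩ V₂ = G.neighborSet v ∩ V₂ ∧
    ∀ x, V₂ = {x} → G.Adj u x ∧ G.Adj v x

/-- The first path is `P_3 = uvw`, and `N(u) = N(w) = {v}` or `N(u) = N(w) = {v, x}` for some `x` on
the second path; if the second path is a single vertex, then this vertex is not isolated. -/
def FormC (G : SimpleGraph V) (V₁ V₂ : Set V) : Prop :=
  ∃ u v w, V₁ = {u, v, w} ∧ u ≠ w ∧ G.Adj u v ∧ G.Adj v w ∧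
    ((G.neighborSet u = {v} ∧ G.neighborSet w = {v}) ∨
      ∃ x ∈ V₂, G.neighborSet u = {v, x} ∧ G.neighborSet w = {v, x}) ∧
    ∀ x, V₂ = {x} → ∃ y, G.Adj x y

/-- The edges between `V₁` and `V₂`, as pairs with first entry in `V₁` and second in `V₂`. -/
def edgesBetween (G : SimpleGraph V) (V₁ V₂ : Set V) : Set (V × V) :=
  {e | e.1 ∈ V₁ ∧ e.2 ∈ V₂ ∧ G.Adj e.1 e.2}

/-- The paths are `v_1 ⋯ v_k` and `w_1 ⋯ w_j` with `k = m + 2` and `j = l + 2`, and the edges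
between them are `v_{k-1}w_1`, `v_kw_2` and at most one of `v_{k-1}w_2`, `v_kw_1`. -/
def FormD (G : SimpleGraph V) (V₁ V₂ : Set V) : Prop :=
  ∃ (m l : ℕ) (p : SimpleGraph.pathGraph (m + 2) ↪g G) (q : SimpleGraph.pathGraph (l + 2) ↪g G),
    Set.range p = V₁ ∧ Set.range q = V₂ ∧
    ∃ v' v w₁ w₂ : V, v' = p ⟨m, by omega⟩ ∧ v = p ⟨m + 1, by omega⟩ ∧
      w₁ = q ⟨0, by omega⟩ ∧ w₂ = q ⟨1, by omega⟩ ∧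
      (edgesBetween G V₁ V₂ = {(v', w₁), (v, w₂)} ∨
        edgesBetween G V₁ V₂ = {(v', w₁), (v, w₂), (v', w₂)} ∨
        edgesBetween G V₁ V₂ = {(v', w₁), (v, w₂), (v, w₁)})

/-- One of the four forms, for an ordered pair of paths with vertex sets `V₁` and `V₂`. -/
def IsListed (G : SimpleGraph V) (V₁ V₂ : Set V) : Prop :=
  FormA G V₁ V₂ ∨ FormB G V₁ V₂ ∨ FormC G V₁ V₂ ∨ FormD G V₁ V₂

/-- The drawing has one of the listed forms; either path may play the role of the first one. -/
def StandardDrawing.HasListedForm {G : SimpleGraph V} (D : StandardDrawing G) : Prop :=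
  IsListed G (Set.range D.p) (Set.range D.q) ∨ IsListed G (Set.range D.q) (Set.range D.p)

end ZeroForcingSpan

namespace ZeroForcingSpan

/-! A set of blue vertices gets stuck exactly when its complement is a fort, so a set is zero
forcing if and only if it meets every fort (`isZeroForcing_iff`). Let Z be the least size of a zero
forcing set and F the least size of a fort. Zero forcing sets exist in the sizes from Z to n,
non-forcing sets in the sizes up to n - F, hence λ = n + 1 - F - Z (`span_add_eq`). Thus λ = n - 3
means F + Z = 4, and as both numbers are positive there are three cases.

If F = 1, there is an isolated vertex; deleting it lowers Z by one, and Z = 2 characterizes graphs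
of two parallel paths (`twoParallelPaths_iff`): the two forcing chains are the paths, and conversely
the two first vertices force everything because edges do not cross.

If Z = 1, the graph is a path, and forts of a path on n vertices have more than n/2 vertices up to
rounding (`IsFort.le_card_of_path`), so F = 3 leaves only n = 4 and n = 5.

If F = Z = 2, a fort of size two is a pair of twins, and no vertex is isolated. The listed forms
record where twins can lie in a drawing: on one path they give forms B and C, on different paths A,
B (a triangle) or D (`Twins.isListed`). Conversely each form exhibits twins (`IsListed.twins`). -/

/-- A fort is a nonempty set such that no vertex outside has exactly one neighbor inside. -/
def IsFort {V : Type*} (G : SimpleGraph V) (W : Finset V) : Prop :=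
  W.Nonempty ∧ ∀ u ∉ W, ∀ w ∈ W, G.Adj u w → ∃ w' ∈ W, w' ≠ w ∧ G.Adj u w'

/-! ### Forts, the two extremal sizes and the formula for the span -/

section Forts

variable {V : Type*} {G : SimpleGraph V}

theorem isFort_univ [Fintype V] [Nonempty V] : IsFort G Finset.univ :=
  ⟨Finset.univ_nonempty, fun u hu => absurd (Finset.mem_univ u) hu⟩

variable (G) in
/-- The fort number: the least size of a fort. -/
noncomputable def fortNumber : ℕ := sInf {k | ∃ W : Finset V, IsFort G W ∧ W.card = k}

theorem fortNumber_le {W : Finset V} (hW : IsFort G W) : fortNumber G ≤ W.card :=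
  Nat.sInf_le ⟨W, hW, rfl⟩

variable (G) in
theorem exists_isFort_card [Fintype V] [Nonempty V] :
    ∃ W : Finset V, IsFort G W ∧ W.card = fortNumber G :=
  Nat.sInf_mem (s := {k | ∃ W : Finset V, IsFort G W ∧ W.card = k})
    ⟨_, _, isFort_univ, rfl⟩

theorem one_le_fortNumber [Fintype V] [Nonempty V] : 1 ≤ fortNumber G := by
  obtain ⟨W, hW, hc⟩ := exists_isFort_card G
  rw [← hc]
  exact Finset.card_pos.mpr hW.1

variable [DecidableEq V]

/-- A forcing vertex outside the fort that sees one fort vertex sees a second one, which is white as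
well, so it cannot force into the fort. -/
theorem ColorChange.disjoint_of_isFort {W B B' : Finset V} (hW : IsFort G W)
    (h : ColorChange G B B') (hB : Disjoint W B) : Disjoint W B' := by
  obtain ⟨u, hu, v, hv, huv, rfl⟩ := h
  rw [Finset.disjoint_insert_right]
  refine ⟨fun hvW => ?_, hB⟩
  have huW : u ∉ W := fun h => Finset.disjoint_left.mp hB h hu
  obtain ⟨w', hw', hne, hadj⟩ := hW.2 u huW v hvW ((huv v).mpr rfl).1
  exact hne ((huv w').mp ⟨hadj, Finset.disjoint_left.mp hB hw'⟩)

theorem ColorChange.card {B B' : Finset V} (h : ColorChange G B B') : B'.card = B.card + 1 := by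
  obtain ⟨u, hu, v, hv, huv, rfl⟩ := h
  exact Finset.card_insert_of_notMem hv

variable [Fintype V]

theorem IsZeroForcing.not_disjoint {S W : Finset V} (hS : IsZeroForcing G S) (hW : IsFort G W) :
    ¬ Disjoint W S := by
  intro h
  have key : ∀ B, Relation.ReflTransGen (ColorChange G) S B → Disjoint W B := by
    intro B hB
    induction hB with
    | refl => exact h
    | tail _ h2 ih => exact h2.disjoint_of_isFort hW ih
  obtain ⟨w, hw⟩ := hW.1
  exact Finset.disjoint_left.mp (key _ hS) hw (Finset.mem_univ w)

/-- Failure of the fort condition for the white set is a blue vertex with exactly one white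
neighbor. -/
theorem exists_colorChange {B : Finset V} (hB : B ≠ Finset.univ)
    (h : ¬ IsFort G Bᶜ) : ∃ B', ColorChange G B B' := by
  have hne : (Bᶜ).Nonempty := by
    rwa [Finset.nonempty_iff_ne_empty, ne_eq, Finset.compl_eq_empty_iff]
  simp only [IsFort, hne, true_and] at h
  push Not at h
  obtain ⟨u, hu, w, hw, huw, h⟩ := h
  rw [Finset.mem_compl] at hw
  rw [Finset.mem_compl, not_not] at hu
  refine ⟨_, u, hu, w, hw, fun x => ⟨fun hx => ?_, ?_⟩, rfl⟩
  · by_contra hne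
    exact h x (Finset.mem_compl.mpr hx.2) hne hx.1
  · rintro rfl
    exact ⟨huw, hw⟩

theorem isZeroForcing_of_forall_isFort (S : Finset V)
    (h : ∀ W, IsFort G W → ¬ Disjoint W S) : IsZeroForcing G S := by
  induction hn : Fintype.card V - S.card using Nat.strong_induction_on generalizing S with
  | _ n ih =>
    by_cases hS : S = Finset.univ
    · rw [hS]; exact Relation.ReflTransGen.refl
    obtain ⟨B', hB'⟩ := exists_colorChange hS (fun hf => h _ hf disjoint_compl_left)
    have hlt : S.card < Fintype.card V := Finset.card_lt_univ_of_notMem (x := hB'.choose_spec.2.choose)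
      hB'.choose_spec.2.choose_spec.1
    have hc := hB'.card
    refine Relation.ReflTransGen.head hB' (ih _ (by omega) B' (fun W hW hd => h W hW ?_) rfl)
    obtain ⟨u, hu, v, hv, huv, rfl⟩ := hB'
    exact (Finset.disjoint_insert_right.mp hd).2

theorem isZeroForcing_iff {S : Finset V} :
    IsZeroForcing G S ↔ ∀ W, IsFort G W → ¬ Disjoint W S :=
  ⟨fun h _ hW => h.not_disjoint hW, isZeroForcing_of_forall_isFort S⟩

theorem IsZeroForcing.mono {S T : Finset V} (hS : IsZeroForcing G S) (h : S ⊆ T) :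
    IsZeroForcing G T :=
  isZeroForcing_iff.mpr fun _ hW hd => hS.not_disjoint hW (Finset.disjoint_of_subset_right h hd)

theorem isZeroForcing_univ : IsZeroForcing G Finset.univ := Relation.ReflTransGen.refl

variable (G) in
/-- The zero forcing number: the least size of a zero forcing set. -/
noncomputable def zeroForcingNumber : ℕ :=
  sInf {k | ∃ Z : Finset V, IsZeroForcing G Z ∧ Z.card = k}

theorem zeroForcingNumber_le {Z : Finset V} (hZ : IsZeroForcing G Z) :
    zeroForcingNumber G ≤ Z.card := Nat.sInf_le ⟨Z, hZ, rfl⟩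

variable (G) in
theorem exists_isZeroForcing_card :
    ∃ Z : Finset V, IsZeroForcing G Z ∧ Z.card = zeroForcingNumber G :=
  Nat.sInf_mem (s := {k | ∃ Z : Finset V, IsZeroForcing G Z ∧ Z.card = k})
    ⟨_, _, isZeroForcing_univ, rfl⟩

theorem exists_isZeroForcing_card_eq {k : ℕ} (h : zeroForcingNumber G ≤ k)
    (hk : k ≤ Fintype.card V) : ∃ Z : Finset V, IsZeroForcing G Z ∧ Z.card = k := by
  obtain ⟨Z, hZ, hc⟩ := exists_isZeroForcing_card G
  obtain ⟨T, hT, hTc⟩ := Finset.exists_superset_card_eq (hc ▸ h) hk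
  exact ⟨T, hZ.mono hT, hTc⟩

/-- The non-forcing sets are the subsets of complements of forts, so their possible sizes are
governed by the smallest fort. -/
theorem exists_not_isZeroForcing_card_eq_iff [Nonempty V] {k : ℕ} :
    (∃ F : Finset V, ¬ IsZeroForcing G F ∧ F.card = k) ↔ k + fortNumber G ≤ Fintype.card V := by
  constructor
  · rintro ⟨F, hF, rfl⟩
    rw [isZeroForcing_iff] at hF
    push Not at hF
    obtain ⟨W, hW, hd⟩ := hF
    have h1 := fortNumber_le hW
    have h2 := Finset.card_union_of_disjoint hd
    have h3 := Finset.card_le_univ (W ∪ F)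
    omega
  · intro h
    obtain ⟨W, hW, hc⟩ := exists_isFort_card G
    obtain ⟨F, hF, hFc⟩ := Finset.exists_subset_card_eq (s := Wᶜ) (n := k)
      (by rw [Finset.card_compl]; omega)
    refine ⟨F, fun hz => hz.not_disjoint hW ?_, hFc⟩
    exact Finset.disjoint_left.mpr fun w hw hwF => Finset.mem_compl.mp (hF hwF) hw

theorem one_le_zeroForcingNumber [Nonempty V] : 1 ≤ zeroForcingNumber G := by
  obtain ⟨Z, hZ, hc⟩ := exists_isZeroForcing_card G
  rw [← hc, Nat.one_le_iff_ne_zero, Finset.card_ne_zero]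
  by_contra hne
  rw [Finset.not_nonempty_iff_eq_empty] at hne
  exact hZ.not_disjoint isFort_univ (hne ▸ Finset.disjoint_empty_right _)

theorem span_add_eq [Nonempty V] :
    span G + fortNumber G + zeroForcingNumber G = Fintype.card V + 1 := by
  have hz := one_le_zeroForcingNumber (G := G)
  have hz' : zeroForcingNumber G ≤ Fintype.card V := zeroForcingNumber_le isZeroForcing_univ
  -- Sets of size Z - 1 exist and cannot force. This bound keeps the truncated subtraction in the
  -- size of the interval [Z, n - F] exact, even when the interval is empty.
  have hlow : zeroForcingNumber G - 1 + fortNumber G ≤ Fintype.card V := by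
    rw [← exists_not_isZeroForcing_card_eq_iff]
    obtain ⟨F, -, hF⟩ := Finset.exists_subset_card_eq (s := (Finset.univ : Finset V))
      (n := zeroForcingNumber G - 1) (by rw [Finset.card_univ]; omega)
    refine ⟨F, fun h => ?_, hF⟩
    have := zeroForcingNumber_le h
    omega
  have hset : {k : ℕ | ∃ Z F : Finset V, Z.card = k ∧ F.card = k ∧
      IsZeroForcing G Z ∧ ¬ IsZeroForcing G F} =
      Finset.Icc (zeroForcingNumber G) (Fintype.card V - fortNumber G) := by
    ext k
    simp only [Set.mem_ofPred_eq, Finset.coe_Icc, Set.mem_Icc]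
    constructor
    · rintro ⟨Z, F, rfl, hF, hZ, hF'⟩
      have := exists_not_isZeroForcing_card_eq_iff.mp ⟨F, hF', hF⟩
      exact ⟨zeroForcingNumber_le hZ, by omega⟩
    · rintro ⟨h1, h2⟩
      obtain ⟨Z, hZ, hZc⟩ := exists_isZeroForcing_card_eq h1 (by omega)
      obtain ⟨F, hF, hFc⟩ := exists_not_isZeroForcing_card_eq_iff (G := G) (k := k).mpr (by omega)
      exact ⟨Z, F, hZc, hFc, hZ, hF⟩
  rw [span, hset, Set.ncard_coe_finset, Nat.card_Icc]
  omega

end Forts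

/-! ### Standard drawings as pairs of ordered paths -/

/-- A partition of the vertices into two induced paths, the edges between them being pairwise
noncrossing for the orders of the paths. -/
structure PathPair {V : Type*} (G : SimpleGraph V) where
  k : ℕ
  j : ℕ
  k_pos : 0 < k
  j_pos : 0 < j
  p : SimpleGraph.pathGraph k ↪g G
  q : SimpleGraph.pathGraph j ↪g G
  partition : IsCompl (Set.range p) (Set.range q)
  noncrossing : ∀ {i i' : Fin k} {l l' : Fin j}, G.Adj (p i) (q l) → G.Adj (p i') (q l') →
    i < i' → l ≤ l'

section Drawings

variable {V : Type*} {G : SimpleGraph V}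

/-- The pair with the two paths interchanged. -/
def PathPair.swap (D : PathPair G) : PathPair G where
  k := D.j
  j := D.k
  k_pos := D.j_pos
  j_pos := D.k_pos
  p := D.q
  q := D.p
  partition := D.partition.symm
  noncrossing h h' hlt := by
    by_contra hlt'
    exact absurd (D.noncrossing h'.symm h.symm (not_le.mp hlt')) (not_le.mpr hlt)

theorem PathPair.mem_or_mem (D : PathPair G) (x : V) : (∃ i, D.p i = x) ∨ ∃ l, D.q l = x := by
  have h := D.partition.sup_eq_top
  have hx : x ∈ Set.range D.p ⊔ Set.range D.q := h ▸ Set.mem_univ x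
  exact hx

theorem PathPair.p_ne_q (D : PathPair G) (i : Fin D.k) (l : Fin D.j) : D.p i ≠ D.q l := fun h =>
  Set.disjoint_left.mp D.partition.disjoint ⟨i, rfl⟩ ⟨l, h.symm⟩

theorem PathPair.adj_p (D : PathPair G) {i i' : Fin D.k} :
    G.Adj (D.p i) (D.p i') ↔ i.val + 1 = i'.val ∨ i'.val + 1 = i.val := by
  rw [D.p.map_adj_iff, SimpleGraph.pathGraph_adj]

theorem PathPair.adj_q (D : PathPair G) {i i' : Fin D.j} :
    G.Adj (D.q i) (D.q i') ↔ i.val + 1 = i'.val ∨ i'.val + 1 = i.val := D.swap.adj_p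

/-- The pair of paths of a standard drawing. -/
def StandardDrawing.toPathPair (D : StandardDrawing G) : PathPair G where
  k := D.k
  j := D.j
  k_pos := D.k_pos
  j_pos := D.j_pos
  p := D.p
  q := D.q
  partition := D.partition
  noncrossing {i i' l l'} h h' hlt := by
    by_contra hlt'
    rw [not_le] at hlt'
    refine Set.not_disjoint_iff.mpr ?_ (D.not_crossing i i' l l' h h'
      (fun he => hlt.ne (congrArg Prod.fst he)))
    have hs := sub_pos.mpr (D.s_mono hlt)
    have ht := sub_pos.mpr (D.t_mono hlt')
    set A := D.s i' - D.s i with hA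
    set B := D.t l - D.t l' with hB
    have hAB : A + B ≠ 0 := (add_pos hs ht).ne'
    -- The endpoints are in opposite orders on the two lines, at distances proportional to `A` and
    -- `B`; by similar triangles the segments meet at the fraction A / (A + B) of the way from the
    -- first line to the second.
    refine ⟨(B / (A + B)) • D.pos (D.p i) + (A / (A + B)) • D.pos (D.q l),
      ⟨_, _, by positivity, by positivity, by field_simp; ring, rfl⟩,
      ⟨B / (A + B), A / (A + B), by positivity, by positivity, by field_simp; ring, ?_⟩⟩
    have e1 : D.s i' = D.s i + A := by rw [hA]; ring
    have e2 : D.t l = D.t l' + B := by rw [hB]; ring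
    rw [D.pos_p, D.pos_p, D.pos_q, D.pos_q, e1, e2]
    ext
    · simp only [Prod.fst_add, Prod.smul_fst, smul_eq_mul]
      field_simp
      ring
    · simp only [Prod.snd_add, Prod.smul_snd, smul_eq_mul]
      field_simp
      ring

/-- A common point has one height, hence the same weights on both segments. Equal abscissas then
make a positive combination of the two index differences vanish, while noncrossing gives these
differences compatible signs. -/
theorem PathPair.disjoint_openSegment (D : PathPair G) {i i' : Fin D.k} {l l' : Fin D.j}
    (h : G.Adj (D.p i) (D.q l)) (h' : G.Adj (D.p i') (D.q l')) (hne : (i, l) ≠ (i', l')) :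
    Disjoint (openSegment ℝ ((i.val : ℝ), (0 : ℝ)) ((l.val : ℝ), (1 : ℝ)))
      (openSegment ℝ ((i'.val : ℝ), (0 : ℝ)) ((l'.val : ℝ), (1 : ℝ))) := by
  rw [Set.disjoint_left]
  rintro _ ⟨x, y, hx, hy, hxy, rfl⟩ ⟨x', y', hx', hy', hxy', he⟩
  simp only [Prod.smul_mk, Prod.mk_add_mk, smul_eq_mul, Prod.mk.injEq, mul_zero, mul_one,
    zero_add] at he
  obtain ⟨he, rfl⟩ := he
  obtain rfl : x' = x := by linarith
  have key : x' * ((i'.val : ℝ) - i.val) + y' * ((l'.val : ℝ) - l.val) = 0 := by linarith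
  have cast_lt : ∀ {n : ℕ} {a b : Fin n}, a < b → (a.val : ℝ) < b.val := fun h => by
    exact_mod_cast h
  have cast_le : ∀ {n : ℕ} {a b : Fin n}, a ≤ b → (a.val : ℝ) ≤ b.val := fun h => by
    exact_mod_cast h
  rcases lt_trichotomy i i' with hi | rfl | hi
  · have := mul_pos hx (sub_pos.mpr (cast_lt hi))
    have := mul_nonneg hy.le (sub_nonneg.mpr (cast_le (D.noncrossing h h' hi)))
    linarith
  · rcases lt_trichotomy l l' with hl | rfl | hl
    · have := mul_pos hy (sub_pos.mpr (cast_lt hl))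
      linarith
    · exact hne rfl
    · have := mul_pos hy (sub_pos.mpr (cast_lt hl))
      linarith
  · have := mul_pos hx (sub_pos.mpr (cast_lt hi))
    have := mul_nonneg hy.le (sub_nonneg.mpr (cast_le (D.noncrossing h' h hi)))
    linarith

/-- The positions of the vertices when the two paths are drawn at integer points of two horizontal
lines. -/
noncomputable def PathPair.pos (D : PathPair G) : V → ℝ × ℝ :=
  Function.extend D.p (fun i => ((i.val : ℝ), 0))
    (Function.extend D.q (fun l => ((l.val : ℝ), 1)) 0)

theorem PathPair.pos_p (D : PathPair G) (i : Fin D.k) : D.pos (D.p i) = ((i.val : ℝ), 0) :=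
  D.p.injective.extend_apply _ _ i

theorem PathPair.pos_q (D : PathPair G) (l : Fin D.j) : D.pos (D.q l) = ((l.val : ℝ), 1) := by
  rw [pos, Function.extend_apply' _ _ _ (fun ⟨i, hi⟩ => D.p_ne_q i l hi)]
  exact D.q.injective.extend_apply _ _ l

/-- A standard drawing of a pair of paths. -/
noncomputable def PathPair.toStandardDrawing (D : PathPair G) : StandardDrawing G where
  k := D.k
  j := D.j
  k_pos := D.k_pos
  j_pos := D.j_pos
  p := D.p
  q := D.q
  partition := D.partition
  pos := D.pos
  a := (0, 0)
  b := (0, 1)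
  d := (1, 0)
  distinct_lines := by
    rw [LinearIndependent.pair_iff]
    intro s t h
    simpa using h
  s i := i.val
  t l := l.val
  s_mono _ _ h := Nat.cast_lt.mpr h
  t_mono _ _ h := Nat.cast_lt.mpr h
  pos_p i := by rw [D.pos_p]; simp
  pos_q l := by rw [D.pos_q]; simp
  not_crossing i i' l l' h h' hne := by
    rw [D.pos_p, D.pos_p, D.pos_q, D.pos_q]
    exact D.disjoint_openSegment h h' hne

theorem nonempty_standardDrawing_iff : Nonempty (StandardDrawing G) ↔ Nonempty (PathPair G) :=
  ⟨fun ⟨D⟩ => ⟨D.toPathPair⟩, fun ⟨D⟩ => ⟨D.toStandardDrawing⟩⟩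

/-- A fort that avoids the first vertex of the second path meets the first path. -/
theorem PathPair.exists_mem_fort (D : PathPair G) {W : Finset V} (hW : IsFort G W)
    (h0 : D.q ⟨0, D.j_pos⟩ ∉ W) : ∃ i, D.p i ∈ W := by
  classical
  by_contra! hp
  -- The vertex before the first fort vertex of the second path would have no other fort neighbor.
  have hq : ∀ n (hn : n < D.j), D.q ⟨n, hn⟩ ∉ W := by
    intro n
    induction n using Nat.strong_induction_on with
    | _ n ih =>
      intro hn hmem
      rcases n with _ | n
      · exact h0 hmem
      obtain ⟨w, hw, hne, hadj⟩ := hW.2 (D.q ⟨n, by omega⟩) (ih n (by omega) _) _ hmem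
        (D.adj_q.mpr (Or.inl rfl))
      rcases D.mem_or_mem w with ⟨i, rfl⟩ | ⟨l, rfl⟩
      · exact hp i hw
      rcases D.adj_q.mp hadj with h | h
      · exact hne (congrArg D.q (Fin.ext h.symm))
      · exact ih l.val (by simp at h; omega) l.isLt hw
  obtain ⟨w, hw⟩ := hW.1
  rcases D.mem_or_mem w with ⟨i, rfl⟩ | ⟨l, rfl⟩
  · exact hp i hw
  · exact hq l.val l.isLt hw

/-- The vertex before the first fort vertex of the first path is adjacent to a fort vertex of
the second path. -/
theorem PathPair.exists_adj_of_first (D : PathPair G) {W : Finset V} (hW : IsFort G W)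
    (h0 : D.p ⟨0, D.k_pos⟩ ∉ W) {i : Fin D.k} (hi : D.p i ∈ W) (hmin : ∀ i' < i, D.p i' ∉ W) :
    ∃ i' < i, (∀ a : Fin D.k, i' < a → i ≤ a) ∧ ∃ l, D.q l ∈ W ∧ G.Adj (D.p i') (D.q l) := by
  obtain ⟨n, hn⟩ := i
  rcases n with _ | n
  · exact absurd hi h0
  have hlt : (⟨n, by omega⟩ : Fin D.k) < ⟨n + 1, hn⟩ := Fin.mk_lt_mk.mpr (by omega)
  refine ⟨⟨n, by omega⟩, hlt, fun a ha => ?_, ?_⟩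
  · rw [Fin.lt_def] at ha
    rw [Fin.le_def]
    exact ha
  obtain ⟨w, hw, hne, hadj⟩ := hW.2 _ (hmin _ hlt) _ hi (D.adj_p.mpr (Or.inl rfl))
  rcases D.mem_or_mem w with ⟨i, rfl⟩ | ⟨l, rfl⟩
  · rcases D.adj_p.mp hadj with h | h
    · exact absurd (congrArg D.p (Fin.ext h.symm)) hne
    · refine absurd hw (hmin i (Fin.lt_def.mpr ?_))
      simp at h ⊢
      omega
  · exact ⟨l, hw, hadj⟩

/-- A fort avoiding both starting vertices would have first vertices at positions i and l on the two
paths. The vertices just before them each need a second fort neighbor, on the other path and at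
position at least l or i respectively; these two edges cross. -/
theorem PathPair.isZeroForcing [Fintype V] [DecidableEq V] (D : PathPair G) :
    IsZeroForcing G {D.p ⟨0, D.k_pos⟩, D.q ⟨0, D.j_pos⟩} := by
  classical
  rw [isZeroForcing_iff]
  intro W hW hd
  simp only [Finset.disjoint_insert_right, Finset.disjoint_singleton_right] at hd
  obtain ⟨hp0, hq0⟩ := hd
  obtain ⟨i, hi, himin⟩ := exists_minimal_of_wellFoundedLT (fun i => D.p i ∈ W)
    (D.exists_mem_fort hW hq0)
  obtain ⟨l, hl, hlmin⟩ := exists_minimal_of_wellFoundedLT (fun l => D.q l ∈ W)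
    (D.swap.exists_mem_fort hW hp0)
  have himin' : ∀ i' < i, D.p i' ∉ W := fun i' h h' => absurd (himin h' h.le) (not_le.mpr h)
  have hlmin' : ∀ l' < l, D.q l' ∉ W := fun i' h h' => absurd (hlmin h' h.le) (not_le.mpr h)
  obtain ⟨i', hi', hi'', l₁, hl₁, hadj⟩ := D.exists_adj_of_first hW hp0 hi himin'
  obtain ⟨l', hl', hl'', i₁, hi₁, hadj'⟩ := D.swap.exists_adj_of_first hW hq0 hl hlmin'
  have h1 : i ≤ i₁ := not_lt.mp fun h => himin' _ h hi₁
  have h2 : l ≤ l₁ := not_lt.mp fun h => hlmin' _ h hl₁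
  exact absurd (D.noncrossing hadj hadj'.symm (hi'.trans_le h1)) (not_le.mpr (hl'.trans_le h2))

theorem PathPair.zeroForcingNumber_le [Fintype V] [DecidableEq V] (D : PathPair G) :
    zeroForcingNumber G ≤ 2 :=
  (ZeroForcingSpan.zeroForcingNumber_le D.isZeroForcing).trans Finset.card_le_two

end Drawings

/-! ### Forcing chains: small zero forcing sets yield one or two paths -/

/-- The blue set `B` is the disjoint union of two induced paths `p 0, …, p (k - 1)` and
`q 0, …, q (j - 1)`, possibly empty, with noncrossing edges between them, in which only the last
vertices may have white neighbors. -/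
structure ForcingPaths {V : Type*} (G : SimpleGraph V) (B : Finset V) (k j : ℕ) (p q : ℕ → V) :
    Prop where
  mem_iff : ∀ x, x ∈ B ↔ (∃ i < k, p i = x) ∨ ∃ l < j, q l = x
  inj_p : ∀ i < k, ∀ i' < k, p i = p i' → i = i'
  inj_q : ∀ i < j, ∀ i' < j, q i = q i' → i = i'
  p_ne_q : ∀ i < k, ∀ l < j, p i ≠ q l
  adj_p : ∀ i < k, ∀ i' < k, G.Adj (p i) (p i') ↔ i + 1 = i' ∨ i' + 1 = i
  adj_q : ∀ i < j, ∀ i' < j, G.Adj (q i) (q i') ↔ i + 1 = i' ∨ i' + 1 = i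
  closed_p : ∀ i, i + 1 < k → ∀ w, G.Adj (p i) w → w ∈ B
  closed_q : ∀ i, i + 1 < j → ∀ w, G.Adj (q i) w → w ∈ B
  noncrossing : ∀ i < k, ∀ i' < k, ∀ l < j, ∀ l' < j, G.Adj (p i) (q l) → G.Adj (p i') (q l') →
    i < i' → l ≤ l'

section Forcing

variable {V : Type*} {G : SimpleGraph V}

theorem ForcingPaths.swap {B : Finset V} {k j : ℕ} {p q : ℕ → V} (h : ForcingPaths G B k j p q) :
    ForcingPaths G B j k q p where
  mem_iff x := (h.mem_iff x).trans or_comm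
  inj_p := h.inj_q
  inj_q := h.inj_p
  p_ne_q i hi l hl := (h.p_ne_q l hl i hi).symm
  adj_p := h.adj_q
  adj_q := h.adj_p
  closed_p := h.closed_q
  closed_q := h.closed_p
  noncrossing i hi i' hi' l hl l' hl' ha ha' hlt := by
    by_contra hlt'
    have := h.noncrossing l' hl' l hl i' hi' i hi ha'.symm ha.symm (not_le.mp hlt')
    omega

/-- Only the last vertex of a chain can force, so the new vertex is appended at position `k`. Its
neighbors in the other chain can only be that chain's last vertex, since the earlier ones have no
white neighbors; hence no crossing arises. -/
theorem ForcingPaths.extend [DecidableEq V] {B : Finset V} {k j : ℕ} {p q : ℕ → V}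
    (h : ForcingPaths G B k j p q) {i : ℕ} (hi : i < k) {v : V} (hv : v ∉ B)
    (huv : ∀ w, (G.Adj (p i) w ∧ w ∉ B) ↔ w = v) :
    ForcingPaths G (insert v B) (k + 1) j (Function.update p k v) q := by
  have hav : G.Adj (p i) v := ((huv v).mpr rfl).1
  have hpB : ∀ a < k, p a ∈ B := fun a ha => (h.mem_iff _).mpr (Or.inl ⟨a, ha, rfl⟩)
  have hqB : ∀ a < j, q a ∈ B := fun a ha => (h.mem_iff _).mpr (Or.inr ⟨a, ha, rfl⟩)
  obtain rfl : k = i + 1 := by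
    by_contra hne
    exact hv (h.closed_p i (by omega) v hav)
  have hold : ∀ a < i + 1, Function.update p (i + 1) v a = p a := fun a ha =>
    Function.update_of_ne (by omega) _ _
  have hnew : Function.update p (i + 1) v (i + 1) = v := Function.update_self _ _ _
  have hadj : ∀ a < i + 1, G.Adj (p a) v ↔ a = i := fun a ha =>
    ⟨fun hadj => by
      by_contra hne
      exact hv (h.closed_p a (by omega) v hadj), fun he => he ▸ hav⟩
  have hqadj : ∀ a < j, G.Adj (q a) v → a + 1 = j := fun a ha hadj => by
    by_contra hne
    exact hv (h.closed_q a (by omega) v hadj)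
  have hcases : ∀ a < i + 1 + 1, a < i + 1 ∨ a = i + 1 := fun a ha => by omega
  refine ⟨fun x => ?_, fun a ha b hb => ?_, h.inj_q, fun a ha l hl => ?_, fun a ha b hb => ?_,
    h.adj_q, fun a ha w hw => ?_, fun a ha w hw => Finset.mem_insert_of_mem (h.closed_q a ha w hw),
    fun a ha b hb l hl l' hl' => ?_⟩
  · rw [Finset.mem_insert, h.mem_iff]
    constructor
    · rintro (rfl | ⟨a, ha, rfl⟩ | hx)
      · exact Or.inl ⟨i + 1, by omega, hnew⟩
      · exact Or.inl ⟨a, by omega, hold a ha⟩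
      · exact Or.inr hx
    · rintro (⟨a, ha, rfl⟩ | hx)
      · rcases hcases a ha with ha | rfl
        · exact Or.inr (Or.inl ⟨a, ha, (hold a ha).symm⟩)
        · exact Or.inl hnew
      · exact Or.inr (Or.inr hx)
  · rcases hcases a ha with ha | rfl <;> rcases hcases b hb with hb | rfl
    · rw [hold a ha, hold b hb]
      exact h.inj_p a ha b hb
    · rw [hold a ha, hnew]
      exact fun he => absurd (hpB a ha) (he ▸ hv)
    · rw [hold b hb, hnew]
      exact fun he => absurd (hpB b hb) (he ▸ hv)
    · exact fun _ => rfl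
  · rcases hcases a ha with ha | rfl
    · rw [hold a ha]
      exact h.p_ne_q a ha l hl
    · rw [hnew]
      exact fun he => hv (he ▸ hqB l hl)
  · rcases hcases a ha with ha | rfl <;> rcases hcases b hb with hb | rfl
    · rw [hold a ha, hold b hb]
      exact h.adj_p a ha b hb
    · rw [hold a ha, hnew, hadj a ha]
      omega
    · rw [hold b hb, hnew, G.adj_comm, hadj b hb]
      omega
    · simp
  · rw [hold a (by omega)] at hw
    by_contra hwB
    rw [Finset.mem_insert, not_or] at hwB
    rcases Nat.lt_or_ge (a + 1) (i + 1) with ha' | ha'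
    · exact hwB.2 (h.closed_p a ha' w hw)
    · obtain rfl : a = i := by omega
      exact hwB.1 ((huv w).mp ⟨hw, hwB.2⟩)
  · rcases hcases a ha with ha | rfl <;> rcases hcases b hb with hb | rfl
    · rw [hold a ha, hold b hb]
      exact h.noncrossing a ha b hb l hl l' hl'
    · rw [hnew]
      intro _ h2 _
      have := hqadj l' hl' h2.symm
      omega
    · omega
    · omega

/-- The equivalences record that an empty chain stays empty and a nonempty one nonempty, which
separates one final path from two. -/
theorem ForcingPaths.exists_of_isZeroForcing [Fintype V] [DecidableEq V] {B : Finset V} {k j : ℕ}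
    {p q : ℕ → V} (h : ForcingPaths G B k j p q) (hB : IsZeroForcing G B) :
    ∃ k' j' p' q', ForcingPaths G Finset.univ k' j' p' q' ∧ (k = 0 ↔ k' = 0) ∧
      (j = 0 ↔ j' = 0) := by
  induction hB using Relation.ReflTransGen.head_induction_on generalizing k j p q with
  | refl => exact ⟨k, j, p, q, h, Iff.rfl, Iff.rfl⟩
  | head hc _ ih =>
    obtain ⟨u, hu, v, hv, huv, rfl⟩ := hc
    rcases (h.mem_iff u).mp hu with ⟨i, hi, rfl⟩ | ⟨i, hi, rfl⟩
    · obtain ⟨k', j', p', q', h', hk, hj⟩ := ih (h.extend hi hv huv)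
      exact ⟨k', j', p', q', h', by omega, hj⟩
    · obtain ⟨k', j', p', q', h', hk, hj⟩ := ih (h.swap.extend hi hv huv).swap
      exact ⟨k', j', p', q', h', hk, by omega⟩

theorem forcingPaths_pair [DecidableEq V] {a b : V} (hab : a ≠ b) :
    ForcingPaths G {a, b} 1 1 (fun _ => a) (fun _ => b) := by
  constructor <;> simp +contextual [hab, eq_comm]

theorem forcingPaths_singleton [DecidableEq V] (a : V) :
    ForcingPaths G {a} 1 0 (fun _ => a) (fun _ => a) := by
  constructor <;> simp +contextual [eq_comm]

/-- The first path of a family of forcing paths, as an embedded path. -/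
def ForcingPaths.embedding {B : Finset V} {k j : ℕ} {p q : ℕ → V} (h : ForcingPaths G B k j p q) :
    SimpleGraph.pathGraph k ↪g G where
  toFun i := p i
  inj' i i' he := Fin.ext (h.inj_p _ i.isLt _ i'.isLt he)
  map_rel_iff' {i i'} := by
    rw [SimpleGraph.pathGraph_adj]
    exact h.adj_p _ i.isLt _ i'.isLt

theorem ForcingPaths.nonempty_pathPair [Fintype V] {k j : ℕ} {p q : ℕ → V}
    (h : ForcingPaths G Finset.univ k j p q) (hk : k ≠ 0) (hj : j ≠ 0) :
    Nonempty (PathPair G) := by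
  refine ⟨⟨k, j, Nat.pos_of_ne_zero hk, Nat.pos_of_ne_zero hj, h.embedding, h.swap.embedding, ?_,
    fun {i i' l l'} => h.noncrossing _ i.isLt _ i'.isLt _ l.isLt _ l'.isLt⟩⟩
  refine ⟨Set.disjoint_left.mpr ?_, codisjoint_iff.mpr (Set.eq_univ_of_forall fun x => ?_)⟩
  · rintro _ ⟨i, rfl⟩ ⟨l, he⟩
    exact h.p_ne_q i i.isLt l l.isLt he.symm
  · rcases (h.mem_iff x).mp (Finset.mem_univ x) with ⟨i, hi, rfl⟩ | ⟨i, hi, rfl⟩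
    · exact Or.inl ⟨⟨i, hi⟩, rfl⟩
    · exact Or.inr ⟨⟨i, hi⟩, rfl⟩

theorem ForcingPaths.isPathOn [Fintype V] {k : ℕ} {p q : ℕ → V}
    (h : ForcingPaths G Finset.univ k 0 p q) : IsPathOn G k := by
  refine ⟨(RelIso.ofSurjective h.embedding fun x => ?_).symm⟩
  rcases (h.mem_iff x).mp (Finset.mem_univ x) with ⟨i, hi, rfl⟩ | ⟨i, hi, rfl⟩
  · exact ⟨⟨i, hi⟩, rfl⟩
  · omega

end Forcing

section Numbers

variable {V : Type*} [Fintype V] [DecidableEq V] {G : SimpleGraph V}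

theorem nonempty_pathPair_of_zeroForcingNumber (h : zeroForcingNumber G = 2) :
    Nonempty (PathPair G) := by
  obtain ⟨Z, hZ, hc⟩ := exists_isZeroForcing_card G
  rw [h, Finset.card_eq_two] at hc
  obtain ⟨a, b, hab, rfl⟩ := hc
  obtain ⟨k, j, p, q, hpq, hk, hj⟩ := (forcingPaths_pair hab).exists_of_isZeroForcing hZ
  exact hpq.nonempty_pathPair (by omega) (by omega)

theorem exists_isPathOn_of_zeroForcingNumber (h : zeroForcingNumber G = 1) :
    ∃ n, IsPathOn G n := by
  obtain ⟨Z, hZ, hc⟩ := exists_isZeroForcing_card G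
  rw [h, Finset.card_eq_one] at hc
  obtain ⟨a, rfl⟩ := hc
  obtain ⟨k, j, p, q, hpq, hk, hj⟩ := (forcingPaths_singleton a).exists_of_isZeroForcing hZ
  obtain rfl : j = 0 := by omega
  exact ⟨k, hpq.isPathOn⟩

end Numbers

/-! ### Forts of paths, and two parallel paths as zero forcing number two -/

section Paths

variable {V : Type*} {G : SimpleGraph V}

theorem IsFort.map {U : Type*} {H : SimpleGraph U} {W : Finset U} (hW : IsFort H W)
    (e : H ≃g G) : IsFort G (W.map e.toEquiv.toEmbedding) := by
  refine ⟨hW.1.map, fun u hu w hw huw => ?_⟩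
  obtain ⟨u, rfl⟩ := e.surjective u
  obtain ⟨w, hwW, rfl⟩ := Finset.mem_map.mp hw
  obtain ⟨w', hw', hne, hadj⟩ := hW.2 u (fun h => hu (Finset.mem_map_of_mem _ h)) w hwW
    (e.map_adj_iff.mp huw)
  exact ⟨e w', Finset.mem_map_of_mem _ hw', fun h => hne (e.injective h), e.map_adj_iff.mpr hadj⟩

/-- A vertex of a path outside a fort has a fort vertex on one side if and only if it has one on
the other side. -/
theorem IsFort.mem_path_iff {n : ℕ} (e : G ≃g SimpleGraph.pathGraph n) {W : Finset V}
    (hW : IsFort G W) {i : ℕ} (hi : i < n) (hiW : ∀ x ∈ W, (e x).val ≠ i) :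
    (∃ x ∈ W, (e x).val = i + 1) ↔ ∃ x ∈ W, (e x).val + 1 = i := by
  have hu : e.symm ⟨i, hi⟩ ∉ W := fun h => hiW _ h (by rw [e.apply_symm_apply])
  have hadj : ∀ w, G.Adj (e.symm ⟨i, hi⟩) w ↔ i + 1 = (e w).val ∨ (e w).val + 1 = i := fun w => by
    rw [← e.map_adj_iff, e.apply_symm_apply, SimpleGraph.pathGraph_adj]
  constructor
  · rintro ⟨x, hx, hxi⟩
    obtain ⟨w, hw, hne, hw'⟩ := hW.2 _ hu x hx ((hadj x).mpr (Or.inl hxi.symm))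
    rcases (hadj w).mp hw' with h | h
    · exact absurd (e.injective (Fin.ext (by omega))) hne
    · exact ⟨w, hw, h⟩
  · rintro ⟨x, hx, hxi⟩
    obtain ⟨w, hw, hne, hw'⟩ := hW.2 _ hu x hx ((hadj x).mpr (Or.inr hxi))
    rcases (hadj w).mp hw' with h | h
    · exact ⟨w, hw, h.symm⟩
    · exact absurd (e.injective (Fin.ext (by omega))) hne

/-- If position 0 is outside, so is position 1, as 0 has no other neighbor. Two consecutive
positions outside force the next one outside, so the fort would be empty. -/
theorem IsFort.exists_path_zero {n : ℕ} (e : G ≃g SimpleGraph.pathGraph n) {W : Finset V}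
    (hW : IsFort G W) : ∃ x ∈ W, (e x).val = 0 := by
  by_contra! h0
  have key : ∀ i, (∀ x ∈ W, (e x).val ≠ i) ∧ ∀ x ∈ W, (e x).val ≠ i + 1 := by
    intro i
    induction i with
    | zero =>
      refine ⟨h0, fun x hx hxi => ?_⟩
      obtain ⟨y, hy, hyi⟩ := (hW.mem_path_iff e (Nat.zero_lt_of_lt (e x).isLt) h0).mp ⟨x, hx, hxi⟩
      omega
    | succ i ih =>
      refine ⟨ih.2, fun x hx hxi => ?_⟩
      obtain ⟨y, hy, hyi⟩ := (hW.mem_path_iff e (by have := (e x).isLt; omega) ih.2).mp ⟨x, hx, hxi⟩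
      exact ih.1 y hy (by omega)
  obtain ⟨x, hx⟩ := hW.1
  exact (key _).1 x hx rfl

/-- No two consecutive positions are both outside a fort. For `i = n - 1` this says that the last
vertex belongs to the fort. -/
theorem IsFort.exists_path_succ {n : ℕ} (e : G ≃g SimpleGraph.pathGraph n) {W : Finset V}
    (hW : IsFort G W) {i : ℕ} (hi : i < n) :
    ∃ x ∈ W, (e x).val = i ∨ (e x).val = i + 1 := by
  induction i with
  | zero =>
    obtain ⟨x, hx, h⟩ := hW.exists_path_zero e
    exact ⟨x, hx, Or.inl h⟩
  | succ i ih =>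
    by_contra! h
    obtain ⟨x, hx, hxi⟩ := ih (by omega)
    obtain ⟨y, hy, hyi⟩ := (hW.mem_path_iff e hi fun x hx => (h x hx).1).mpr
      ⟨x, hx, by have := (h x hx).1; omega⟩
    exact (h y hy).2 hyi

/-- The fort contains position 0 and meets each of the disjoint pairs {1, 2}, {3, 4}, …, {2m - 1,
2m}. When 2m = n the last pair consists of the end vertex alone. -/
theorem IsFort.le_card_of_path {n : ℕ} (e : G ≃g SimpleGraph.pathGraph n) {W : Finset V}
    (hW : IsFort G W) {m : ℕ} (hm : 2 * m ≤ n) : m + 1 ≤ W.card := by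
  suffices h : ∀ m, 2 * m ≤ n → m + 1 ≤ (W.filter fun x => (e x).val ≤ 2 * m).card from
    (h m hm).trans (Finset.card_filter_le _ _)
  clear hm m
  intro m
  induction m with
  | zero =>
    intro _
    obtain ⟨x, hx, h⟩ := hW.exists_path_zero e
    exact Finset.card_pos.mpr ⟨x, Finset.mem_filter.mpr ⟨hx, by omega⟩⟩
  | succ m ih =>
    intro hm
    obtain ⟨x, hx, h⟩ := hW.exists_path_succ e (i := 2 * m + 1) (by omega)
    refine (Nat.succ_le_succ (ih (by omega))).trans (Finset.card_lt_card ?_)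
    refine (Finset.ssubset_iff_of_subset fun y hy => ?_).mpr ⟨x, ?_, fun h' => ?_⟩
    · rw [Finset.mem_filter] at hy ⊢
      exact ⟨hy.1, by omega⟩
    · exact Finset.mem_filter.mpr ⟨hx, by omega⟩
    · have := (Finset.mem_filter.mp h').2
      omega

theorem le_fortNumber_of_path [Fintype V] [Nonempty V] {n : ℕ}
    (e : G ≃g SimpleGraph.pathGraph n) {m : ℕ} (hm : 2 * m ≤ n) : m + 1 ≤ fortNumber G := by
  obtain ⟨W, hW, hc⟩ := exists_isFort_card G
  exact hc ▸ hW.le_card_of_path e hm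

theorem IsPathOn.zeroForcingNumber_eq [Fintype V] [DecidableEq V] [Nonempty V] {n : ℕ}
    (h : IsPathOn G n) : zeroForcingNumber G = 1 := by
  obtain ⟨e⟩ := h
  obtain ⟨v⟩ := ‹Nonempty V›
  have hn : 0 < n := Nat.zero_lt_of_lt (e v).isLt
  refine le_antisymm ?_ one_le_zeroForcingNumber
  refine zeroForcingNumber_le (Z := {e.symm ⟨0, hn⟩}) (isZeroForcing_iff.mpr fun W hW hd => ?_)
  obtain ⟨x, hx, hx0⟩ := hW.exists_path_zero e
  refine Finset.disjoint_singleton_right.mp hd ?_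
  rwa [show (⟨0, hn⟩ : Fin n) = e x from Fin.ext hx0.symm, e.symm_apply_apply]

theorem IsPathOn.card_eq [Fintype V] {n : ℕ} (h : IsPathOn G n) : Fintype.card V = n := by
  obtain ⟨e⟩ := h
  rw [Fintype.card_congr e.toEquiv, Fintype.card_fin]

theorem IsPathOn.fortNumber_eq_four [Fintype V] [Nonempty V] (h : IsPathOn G 4) :
    fortNumber G = 3 := by
  obtain ⟨e⟩ := h
  refine le_antisymm ?_ (le_fortNumber_of_path e (m := 2) (by norm_num))
  -- The only outside vertex, 1, sees both 0 and 2.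
  have hW : IsFort (SimpleGraph.pathGraph 4) {0, 2, 3} := by
    simp only [IsFort, SimpleGraph.pathGraph_adj]
    decide
  simpa using fortNumber_le (hW.map e.symm)

theorem IsPathOn.fortNumber_eq_five [Fintype V] [Nonempty V] (h : IsPathOn G 5) :
    fortNumber G = 3 := by
  obtain ⟨e⟩ := h
  refine le_antisymm ?_ (le_fortNumber_of_path e (m := 2) (by norm_num))
  have hW : IsFort (SimpleGraph.pathGraph 5) {0, 2, 4} := by
    simp only [IsFort, SimpleGraph.pathGraph_adj]
    decide
  simpa using fortNumber_le (hW.map e.symm)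

theorem IsPathOn.eq_of_fortNumber [Fintype V] [Nonempty V] {n : ℕ} (h : IsPathOn G n)
    (hf : fortNumber G = 3) : n = 4 ∨ n = 5 := by
  have hcard := h.card_eq
  obtain ⟨e⟩ := h
  have h6 : n < 6 := by
    by_contra hn
    have := le_fortNumber_of_path e (m := 3) (by omega)
    omega
  have h3 : 3 ≤ n := by
    rw [← hcard, ← hf, ← Finset.card_univ]
    exact fortNumber_le isFort_univ
  have hne : n ≠ 3 := by
    rintro rfl
    -- The two ends of P_3 form a fort of size two, which rules out n = 3.
    have hW : IsFort (SimpleGraph.pathGraph 3) {0, 2} := by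
      simp only [IsFort, SimpleGraph.pathGraph_adj]
      decide
    have := fortNumber_le (hW.map e.symm)
    simp at this
    omega
  omega

theorem twoParallelPaths_iff [Fintype V] [DecidableEq V] :
    TwoParallelPaths G ↔ zeroForcingNumber G = 2 := by
  rw [TwoParallelPaths, nonempty_standardDrawing_iff]
  constructor
  · rintro ⟨hp, ⟨D⟩⟩
    have : Nonempty V := ⟨D.p ⟨0, D.k_pos⟩⟩
    have h1 := one_le_zeroForcingNumber (G := G)
    have h2 := D.zeroForcingNumber_le
    have h3 : zeroForcingNumber G ≠ 1 := fun h => hp (exists_isPathOn_of_zeroForcingNumber h)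
    omega
  · intro h
    have hD := nonempty_pathPair_of_zeroForcingNumber h
    refine ⟨fun ⟨n, hn⟩ => ?_, hD⟩
    have : Nonempty V := ⟨hD.some.p ⟨0, hD.some.k_pos⟩⟩
    have := hn.zeroForcingNumber_eq
    omega

end Paths

/-! ### Isolated vertices -/

section Isolated

variable {V : Type*} {G : SimpleGraph V}

theorem isFort_singleton_iff {v : V} : IsFort G {v} ↔ ∀ w, ¬ G.Adj v w := by
  constructor
  · intro h w hvw
    obtain ⟨w', hw', hne, -⟩ := h.2 w (by simpa using hvw.ne') v (Finset.mem_singleton_self v)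
      hvw.symm
    exact hne (Finset.mem_singleton.mp hw')
  · intro h
    refine ⟨Finset.singleton_nonempty v, fun u _ w hw huw => ?_⟩
    rw [Finset.mem_singleton.mp hw] at huw
    exact absurd huw.symm (h u)

theorem fortNumber_eq_one_iff [Fintype V] [Nonempty V] :
    fortNumber G = 1 ↔ ∃ v, ∀ w, ¬ G.Adj v w := by
  constructor
  · intro h
    obtain ⟨W, hW, hc⟩ := exists_isFort_card G
    rw [h, Finset.card_eq_one] at hc
    obtain ⟨v, rfl⟩ := hc
    exact ⟨v, isFort_singleton_iff.mp hW⟩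
  · rintro ⟨v, hv⟩
    exact le_antisymm (fortNumber_le (isFort_singleton_iff.mpr hv)) one_le_fortNumber

theorem IsFort.map_subtype {v : V} {W : Finset ({v}ᶜ : Set V)} (hv : ∀ w, ¬ G.Adj v w)
    (hW : IsFort (G.induce {v}ᶜ) W) : IsFort G (W.map (Function.Embedding.subtype _)) := by
  refine ⟨hW.1.map, fun u hu w hw huw => ?_⟩
  obtain ⟨w, hwW, rfl⟩ := Finset.mem_map.mp hw
  have huv : u ≠ v := by
    rintro rfl
    exact hv _ huw
  obtain ⟨w', hw', hne, hadj⟩ := hW.2 ⟨u, huv⟩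
    (fun h => hu (Finset.mem_map_of_mem (Function.Embedding.subtype _) h)) w hwW huw
  exact ⟨w', Finset.mem_map_of_mem _ hw', fun h => hne (Subtype.ext h), hadj⟩

theorem IsFort.subtype [DecidableEq V] {v : V} {W : Finset V} (hW : IsFort G W)
    (hv : ∀ w, ¬ G.Adj v w) {x : V} (hx : x ∈ W) (hxv : x ≠ v) :
    IsFort (G.induce {v}ᶜ) (W.subtype (· ∈ ({v}ᶜ : Set V))) := by
  refine ⟨⟨⟨x, hxv⟩, Finset.mem_subtype.mpr hx⟩, fun u hu w hw huw => ?_⟩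
  rw [Finset.mem_subtype] at hu hw
  obtain ⟨w', hw', hne, hadj⟩ := hW.2 u hu w hw huw
  have hwv : w' ≠ v := by
    rintro rfl
    exact hv _ hadj.symm
  exact ⟨⟨w', hwv⟩, Finset.mem_subtype.mpr hw', fun h => hne (congrArg Subtype.val h), hadj⟩

/-- An isolated vertex is a fort by itself, so every zero forcing set contains it. Every fort other
than this singleton restricts to a fort of the remaining graph, and forts of the remaining graph are
forts of `G`. -/
theorem zeroForcingNumber_eq_add_one [Fintype V] [DecidableEq V] {v : V}
    (hv : ∀ w, ¬ G.Adj v w) :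
    zeroForcingNumber G = zeroForcingNumber (G.induce {v}ᶜ) + 1 := by
  apply le_antisymm
  · obtain ⟨Z, hZ, hc⟩ := exists_isZeroForcing_card (G.induce {v}ᶜ)
    rw [← hc]
    have hZ' : IsZeroForcing G (insert v (Z.map (Function.Embedding.subtype _))) := by
      refine isZeroForcing_iff.mpr fun W hW hd => ?_
      rw [Finset.disjoint_insert_right] at hd
      obtain ⟨x, hx⟩ := hW.1
      have hxv : x ≠ v := fun h => hd.1 (h ▸ hx)
      refine hZ.not_disjoint (hW.subtype hv hx hxv) (Finset.disjoint_left.mpr fun y hy hyZ => ?_)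
      exact Finset.disjoint_left.mp hd.2 (Finset.mem_subtype.mp hy)
        (Finset.mem_map_of_mem (Function.Embedding.subtype _) hyZ)
    exact (zeroForcingNumber_le hZ').trans ((Finset.card_insert_le _ _).trans
      (by rw [Finset.card_map]))
  · obtain ⟨Z, hZ, hc⟩ := exists_isZeroForcing_card G
    have hvZ : v ∈ Z := by
      by_contra h
      exact hZ.not_disjoint (isFort_singleton_iff.mpr hv) (Finset.disjoint_singleton_left.mpr h)
    have hZ' : IsZeroForcing (G.induce {v}ᶜ) (Z.subtype (· ∈ ({v}ᶜ : Set V))) := by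
      refine isZeroForcing_iff.mpr fun W hW hd => ?_
      refine hZ.not_disjoint (hW.map_subtype hv) (Finset.disjoint_left.mpr fun y hy hyZ => ?_)
      obtain ⟨y, hyW, rfl⟩ := Finset.mem_map.mp hy
      exact Finset.disjoint_left.mp hd hyW (Finset.mem_subtype.mpr hyZ)
    have hcard : (Z.subtype (· ∈ ({v}ᶜ : Set V))).card + 1 ≤ Z.card := by
      rw [Finset.card_subtype]
      refine Finset.card_lt_card ((Finset.ssubset_iff_of_subset (Finset.filter_subset _ _)).mpr
        ⟨v, hvZ, fun h => ?_⟩)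
      exact (Finset.mem_filter.mp h).2 rfl
    rw [← hc]
    exact (Nat.succ_le_succ (zeroForcingNumber_le hZ')).trans hcard

end Isolated

/-! ### Twins as forts of size two -/

/-- Distinct vertices with the same neighbors outside the pair. -/
def Twins {V : Type*} (G : SimpleGraph V) (u v : V) : Prop :=
  u ≠ v ∧ ∀ x, x ≠ u → x ≠ v → (G.Adj u x ↔ G.Adj v x)

section TwinForts

variable {V : Type*} {G : SimpleGraph V}

theorem Twins.symm {u v : V} (h : Twins G u v) : Twins G v u :=
  ⟨h.1.symm, fun x hv hu => (h.2 x hu hv).symm⟩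

theorem isFort_pair_iff [DecidableEq V] {u v : V} (huv : u ≠ v) :
    IsFort G {u, v} ↔ Twins G u v := by
  constructor
  · refine fun h => ⟨huv, fun x hxu hxv => ?_⟩
    have hx : x ∉ ({u, v} : Finset V) := by simp [hxu, hxv]
    constructor
    · intro hadj
      obtain ⟨w, hw, hne, hxw⟩ := h.2 x hx u (by simp) hadj.symm
      obtain rfl : w = v := by simpa [hne] using hw
      exact hxw.symm
    · intro hadj
      obtain ⟨w, hw, hne, hxw⟩ := h.2 x hx v (by simp) hadj.symm
      obtain rfl : w = u := by simpa [hne] using hw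
      exact hxw.symm
  · refine fun h => ⟨Finset.insert_nonempty _ _, fun x hx w hw hxw => ?_⟩
    simp only [Finset.mem_insert, Finset.mem_singleton, not_or] at hx hw
    rcases hw with rfl | rfl
    · exact ⟨v, by simp, huv.symm, ((h.2 x hx.1 hx.2).mp hxw.symm).symm⟩
    · exact ⟨u, by simp, huv, ((h.2 x hx.1 hx.2).mpr hxw.symm).symm⟩

theorem fortNumber_eq_two_iff [Fintype V] [Nonempty V] :
    fortNumber G = 2 ↔ (∃ u v, Twins G u v) ∧ ∀ v, ∃ w, G.Adj v w := by
  classical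
  have hone : (∀ v, ∃ w, G.Adj v w) ↔ fortNumber G ≠ 1 := by
    rw [Ne, fortNumber_eq_one_iff]
    push Not
    rfl
  rw [hone]
  constructor
  · intro h
    obtain ⟨W, hW, hc⟩ := exists_isFort_card G
    rw [h, Finset.card_eq_two] at hc
    obtain ⟨u, v, huv, rfl⟩ := hc
    exact ⟨⟨u, v, (isFort_pair_iff huv).mp hW⟩, by omega⟩
  · rintro ⟨⟨u, v, h⟩, hne⟩
    have h1 := fortNumber_le ((isFort_pair_iff h.1).mpr h)
    rw [Finset.card_pair h.1] at h1
    have := one_le_fortNumber (G := G)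
    omega

/-- Otherwise one vertex would force everything. In this form the assumption that `G` is not a path
excludes small exceptional graphs with twins. -/
theorem exists_isFort_notMem [Fintype V] [DecidableEq V] (h : zeroForcingNumber G = 2) (x : V) :
    ∃ W, IsFort G W ∧ x ∉ W := by
  by_contra! hx
  have hZ : IsZeroForcing G {x} := isZeroForcing_iff.mpr fun W hW hd =>
    Finset.disjoint_singleton_right.mp hd (hx W hW)
  have := zeroForcingNumber_le hZ
  rw [Finset.card_singleton] at this
  omega

end TwinForts

/-! ### From twins to the listed forms -/

section TwinsToForms

variable {V : Type*} {G : SimpleGraph V}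

/-- A further vertex on the first path would give one of the two consecutive twins a path neighbor
that the other lacks, so this path is P_2. -/
theorem Twins.formB_of_adj (D : PathPair G) {a b : Fin D.k} (h : Twins G (D.p a) (D.p b))
    (hab : a.val + 1 = b.val) (hiso : ∀ v, ∃ w, G.Adj v w) :
    FormB G (Set.range D.p) (Set.range D.q) := by
  have key : ∀ i : Fin D.k, i = a ∨ i = b := by
    by_contra! ⟨i, hia, hib⟩
    have h1 : ∀ c : Fin D.k, c ≠ a → c ≠ b →
        ((a.val + 1 = c.val ∨ c.val + 1 = a.val) ↔ (b.val + 1 = c.val ∨ c.val + 1 = b.val)) :=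
      fun c hca hcb => by
        rw [← D.adj_p, ← D.adj_p]
        exact h.2 _ (fun he => hca (D.p.injective he)) (fun he => hcb (D.p.injective he))
    have h2 : ∀ c (hc : c < D.k), c ≠ a.val → c ≠ b.val →
        ((a.val + 1 = c ∨ c + 1 = a.val) ↔ (b.val + 1 = c ∨ c + 1 = b.val)) :=
      fun c hc hca hcb => h1 ⟨c, hc⟩ (Fin.ne_of_val_ne hca) (Fin.ne_of_val_ne hcb)
    have hia' := Fin.val_ne_of_ne hia
    have hib' := Fin.val_ne_of_ne hib
    have hi := i.isLt
    have hb := b.isLt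
    rcases Nat.lt_or_ge i.val a.val with hlt | hge
    · have := h2 (a.val - 1) (by omega) (by omega) (by omega)
      omega
    · have := h2 (b.val + 1) (by omega) (by omega) (by omega)
      omega
  have hq : ∀ l : Fin D.j, G.Adj (D.p a) (D.q l) ↔ G.Adj (D.p b) (D.q l) := fun l =>
    h.2 _ (D.p_ne_q _ _).symm (D.p_ne_q _ _).symm
  refine ⟨D.p a, D.p b, ?_, D.adj_p.mpr (Or.inl hab), ?_, fun x hx => ?_⟩
  · ext x
    constructor
    · rintro ⟨i, rfl⟩
      rcases key i with rfl | rfl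
      · exact Or.inl rfl
      · exact Or.inr rfl
    · rintro (rfl | rfl) <;> exact ⟨_, rfl⟩
  · ext x
    refine and_congr_left ?_
    rintro ⟨l, rfl⟩
    exact hq l
  · obtain ⟨l, rfl⟩ : x ∈ Set.range D.q := hx ▸ Set.mem_singleton x
    obtain ⟨y, hy⟩ := hiso (D.q l)
    rcases D.mem_or_mem y with ⟨i, rfl⟩ | ⟨l', rfl⟩
    · rcases key i with rfl | rfl
      · exact ⟨hy.symm, (hq l).mp hy.symm⟩
      · exact ⟨(hq l).mpr hy.symm, hy.symm⟩
    · have : D.q l' ∈ Set.range D.q := ⟨l', rfl⟩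
      rw [hx] at this
      exact absurd this hy.ne'

/-- The path vertex after the first twin must also be adjacent to the second, so they are at
distance two, and any further path vertex would distinguish them. They share their neighbors on the
other path; two such neighbors would produce crossing edges. -/
theorem Twins.formC_of_lt (D : PathPair G) {a b : Fin D.k} (h : Twins G (D.p a) (D.p b))
    (hab : a.val + 1 < b.val) (hiso : ∀ v, ∃ w, G.Adj v w) :
    FormC G (Set.range D.p) (Set.range D.q) := by
  have h2 : ∀ c (hc : c < D.k), c ≠ a.val → c ≠ b.val →
      ((a.val + 1 = c ∨ c + 1 = a.val) ↔ (b.val + 1 = c ∨ c + 1 = b.val)) :=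
    fun c hc hca hcb => by
      have := h.2 (D.p ⟨c, hc⟩) (fun he => hca (congrArg Fin.val (D.p.injective he)))
        (fun he => hcb (congrArg Fin.val (D.p.injective he)))
      rwa [D.adj_p, D.adj_p] at this
  have hb := b.isLt
  have e1 := h2 (a.val + 1) (by omega) (by omega) (by omega)
  have ha0 : a.val = 0 := by
    by_contra hne
    have := h2 (a.val - 1) (by omega) (by omega) (by omega)
    omega
  have hk : D.k = 3 := by
    by_contra hne
    have := h2 (b.val + 1) (by omega) (by omega) (by omega)
    omega
  obtain ⟨c, hc⟩ : ∃ c : Fin D.k, c.val = 1 := ⟨⟨1, by omega⟩, rfl⟩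
  have key : ∀ i : Fin D.k, i = a ∨ i = c ∨ i = b := fun i => by
    have := i.isLt
    simp only [Fin.ext_iff]
    omega
  have hnadj : ¬ G.Adj (D.p a) (D.p b) := by
    rw [D.adj_p]
    omega
  have hac : G.Adj (D.p a) (D.p c) := D.adj_p.mpr (by omega)
  have hbc : G.Adj (D.p c) (D.p b) := D.adj_p.mpr (by omega)
  have hN : G.neighborSet (D.p b) = G.neighborSet (D.p a) := by
    ext x
    rw [SimpleGraph.mem_neighborSet, SimpleGraph.mem_neighborSet]
    by_cases hxa : x = D.p a
    · subst hxa
      exact iff_of_false (fun h => hnadj h.symm) (G.loopless.irrefl _)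
    by_cases hxb : x = D.p b
    · subst hxb
      exact iff_of_false (G.loopless.irrefl _) hnadj
    exact (h.2 x hxa hxb).symm
  refine ⟨D.p a, D.p c, D.p b, ?_, h.1, hac, hbc, ?_, fun x _ => hiso x⟩
  · ext x
    constructor
    · rintro ⟨i, rfl⟩
      rcases key i with rfl | rfl | rfl <;> simp
    · rintro (rfl | rfl | rfl) <;> exact ⟨_, rfl⟩
  · rw [hN]
    simp only [and_self]
    by_cases hex : ∃ l, G.Adj (D.p a) (D.q l)
    · obtain ⟨l, hl⟩ := hex
      refine Or.inr ⟨D.q l, ⟨l, rfl⟩, ?_⟩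
      have hlb : ∀ {l}, G.Adj (D.p a) (D.q l) → G.Adj (D.p b) (D.q l) := fun {l} h' =>
        (h.2 _ (D.p_ne_q _ _).symm (D.p_ne_q _ _).symm).mp h'
      have hlt : a < b := Fin.lt_def.mpr (by omega)
      ext x
      rw [SimpleGraph.mem_neighborSet]
      constructor
      · intro hx
        rcases D.mem_or_mem x with ⟨i, rfl⟩ | ⟨l', rfl⟩
        · rcases key i with rfl | rfl | rfl
          · exact absurd hx (G.loopless.irrefl _)
          · exact Or.inl rfl
          · exact absurd hx hnadj
        · obtain rfl : l' = l :=
            le_antisymm (D.noncrossing hx (hlb hl) hlt) (D.noncrossing hl (hlb hx) hlt)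
          exact Or.inr rfl
      · rintro (rfl | rfl)
        · exact hac
        · exact hl
    · refine Or.inl ?_
      ext x
      rw [SimpleGraph.mem_neighborSet]
      constructor
      · intro hx
        rcases D.mem_or_mem x with ⟨i, rfl⟩ | ⟨l', rfl⟩
        · rcases key i with rfl | rfl | rfl
          · exact absurd hx (G.loopless.irrefl _)
          · exact rfl
          · exact absurd hx hnadj
        · exact absurd ⟨l', hx⟩ hex
      · rintro rfl
        exact hac

theorem Twins.isListed_same (D : PathPair G) {a b : Fin D.k} (h : Twins G (D.p a) (D.p b))
    (hiso : ∀ v, ∃ w, G.Adj v w) : IsListed G (Set.range D.p) (Set.range D.q) := by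
  have hne : a.val ≠ b.val := fun he => h.1 (congrArg D.p (Fin.ext he))
  rcases Nat.lt_trichotomy (a.val + 1) b.val with hlt | heq | hgt
  · exact Or.inr (Or.inr (Or.inl (h.formC_of_lt D hlt hiso)))
  · exact Or.inr (Or.inl (h.formB_of_adj D heq hiso))
  · rcases Nat.lt_or_ge (b.val + 1) a.val with hlt' | hge
    · exact Or.inr (Or.inr (Or.inl (h.symm.formC_of_lt D hlt' hiso)))
    · exact Or.inr (Or.inl (h.symm.formB_of_adj D (by omega) hiso))

theorem Twins.adj_cross (D : PathPair G) {a : Fin D.k} {b : Fin D.j}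
    (h : Twins G (D.p a) (D.q b)) {l : Fin D.j} (hl : b.val + 1 = l.val ∨ l.val + 1 = b.val) :
    G.Adj (D.p a) (D.q l) :=
  (h.2 _ (D.p_ne_q _ _).symm (fun he => by
    have := congrArg Fin.val (D.q.injective he)
    omega)).mpr (D.adj_q.mpr hl)

theorem Twins.eq_or_of_adj_cross (D : PathPair G) {a : Fin D.k} {b : Fin D.j}
    (h : Twins G (D.p a) (D.q b)) {l : Fin D.j} (hl : G.Adj (D.p a) (D.q l)) :
    l = b ∨ b.val + 1 = l.val ∨ l.val + 1 = b.val := by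
  by_cases hlb : l = b
  · exact Or.inl hlb
  · exact Or.inr (D.adj_q.mp ((h.2 _ (D.p_ne_q _ _).symm
      (fun he => hlb (D.q.injective he))).mp hl))

/-- The single vertex copies the neighbors of `D.q b` on the second path: two if `b` is interior,
one if it is an end. Whether the twins are adjacent is free, which gives the two variants in each
case. -/
theorem Twins.formA_of_single (D : PathPair G) (hk : D.k = 1) (hj : 3 ≤ D.j) {a : Fin D.k}
    {b : Fin D.j} (h : Twins G (D.p a) (D.q b)) : FormA G (Set.range D.p) (Set.range D.q) := by
  have hone : ∀ i : Fin D.k, i = a := fun i => Fin.ext (by omega)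
  have hN : ∀ x, G.Adj (D.p a) x ↔ ∃ l, x = D.q l ∧
      ((b.val + 1 = l.val ∨ l.val + 1 = b.val) ∨ l = b ∧ G.Adj (D.p a) (D.q b)) := by
    intro x
    constructor
    · intro hx
      rcases D.mem_or_mem x with ⟨i, rfl⟩ | ⟨l, rfl⟩
      · rw [hone i] at hx
        exact absurd hx (G.loopless.irrefl _)
      · refine ⟨l, rfl, ?_⟩
        rcases h.eq_or_of_adj_cross D hx with rfl | h'
        · exact Or.inr ⟨rfl, hx⟩
        · exact Or.inl h'
    · rintro ⟨l, rfl, h' | ⟨rfl, h'⟩⟩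
      · exact h.adj_cross D h'
      · exact h'
  have hb := b.isLt
  refine ⟨D.p a, ?_, ?_, ?_⟩
  · ext x
    constructor
    · rintro ⟨i, rfl⟩
      rw [hone i]
      rfl
    · rintro rfl
      exact ⟨a, rfl⟩
  · rw [← Set.image_univ, Set.ncard_image_of_injective _ D.q.injective, Set.ncard_univ,
      Nat.card_fin]
    exact hj
  by_cases hmid : 0 < b.val ∧ b.val + 1 < D.j
  · left
    obtain ⟨c, hc⟩ : ∃ c : Fin D.j, c.val + 1 = b.val := ⟨⟨b.val - 1, by omega⟩, by simp; omega⟩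
    obtain ⟨d, hd⟩ : ∃ d : Fin D.j, b.val + 1 = d.val := ⟨⟨b.val + 1, hmid.2⟩, rfl⟩
    have hl : ∀ l : Fin D.j, (b.val + 1 = l.val ∨ l.val + 1 = b.val) ↔ l = c ∨ l = d := fun l => by
      simp only [Fin.ext_iff]
      omega
    refine ⟨D.q c, ⟨c, rfl⟩, D.q b, ⟨b, rfl⟩, D.q d, ⟨d, rfl⟩, fun he => ?_,
      D.adj_q.mpr (Or.inl hc), D.adj_q.mpr (Or.inl hd), ?_⟩
    · have := congrArg Fin.val (D.q.injective he)
      omega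
    by_cases hadj : G.Adj (D.p a) (D.q b)
    · right
      ext x
      rw [SimpleGraph.mem_neighborSet, hN]
      simp only [hl, hadj, and_true, Set.mem_insert_iff, Set.mem_singleton_iff]
      constructor
      · rintro ⟨l, rfl, (rfl | rfl) | rfl⟩ <;> simp
      · rintro (rfl | rfl | rfl) <;> exact ⟨_, rfl, by simp⟩
    · left
      ext x
      rw [SimpleGraph.mem_neighborSet, hN]
      simp only [hl, hadj, and_false, or_false, Set.mem_insert_iff, Set.mem_singleton_iff]
      constructor
      · rintro ⟨l, rfl, rfl | rfl⟩ <;> simp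
      · rintro (rfl | rfl) <;> exact ⟨_, rfl, by simp⟩
  · right
    obtain ⟨c, hc⟩ : ∃ c : Fin D.j, b.val + 1 = c.val ∨ c.val + 1 = b.val := by
      rcases Nat.eq_zero_or_pos b.val with h0 | h0
      · exact ⟨⟨1, by omega⟩, Or.inl (by simp; omega)⟩
      · exact ⟨⟨b.val - 1, by omega⟩, Or.inr (by simp; omega)⟩
    have hl : ∀ l : Fin D.j, (b.val + 1 = l.val ∨ l.val + 1 = b.val) ↔ l = c := fun l => by
      have := l.isLt
      have := c.isLt
      simp only [Fin.ext_iff]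
      omega
    refine ⟨D.q b, ⟨b, rfl⟩, D.q c, ⟨c, rfl⟩, ?_, ?_⟩
    · ext x
      constructor
      · rintro ⟨hx, l, rfl⟩
        rw [SimpleGraph.mem_neighborSet, D.adj_q, hl] at hx
        rw [hx]
        rfl
      · rintro rfl
        exact ⟨D.adj_q.mpr hc, c, rfl⟩
    by_cases hadj : G.Adj (D.p a) (D.q b)
    · right
      ext x
      rw [SimpleGraph.mem_neighborSet, hN]
      simp only [hl, hadj, and_true, Set.mem_insert_iff, Set.mem_singleton_iff]
      constructor
      · rintro ⟨l, rfl, rfl | rfl⟩ <;> simp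
      · rintro (rfl | rfl) <;> exact ⟨_, rfl, by simp⟩
    · left
      ext x
      rw [SimpleGraph.mem_neighborSet, hN]
      simp only [hl, hadj, and_false, or_false, Set.mem_singleton_iff]
      constructor
      · rintro ⟨l, rfl, rfl⟩
        rfl
      · rintro rfl
        exact ⟨_, rfl, rfl⟩

theorem Twins.formB_of_triangle (D : PathPair G) (hk : D.k = 1) (hj : D.j = 2) {a : Fin D.k}
    {b : Fin D.j} (h : Twins G (D.p a) (D.q b)) (hadj : G.Adj (D.p a) (D.q b)) :
    FormB G (Set.range D.q) (Set.range D.p) := by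
  have hone : ∀ i : Fin D.k, i = a := fun i => Fin.ext (by omega)
  obtain ⟨c, hc⟩ : ∃ c : Fin D.j, b.val + 1 = c.val ∨ c.val + 1 = b.val := by
    rcases Nat.eq_zero_or_pos b.val with h0 | h0
    · exact ⟨⟨1, by omega⟩, Or.inl (by simp; omega)⟩
    · exact ⟨⟨b.val - 1, by omega⟩, Or.inr (by simp; omega)⟩
  have hac := h.adj_cross D hc
  have hcases : ∀ l : Fin D.j, l = b ∨ l = c := fun l => by
    simp only [Fin.ext_iff]
    omega
  refine ⟨D.q b, D.q c, ?_, D.adj_q.mpr hc, ?_, fun x hx => ?_⟩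
  · ext x
    constructor
    · rintro ⟨l, rfl⟩
      rcases hcases l with rfl | rfl <;> simp
    · rintro (rfl | rfl) <;> exact ⟨_, rfl⟩
  · ext x
    refine and_congr_left ?_
    rintro ⟨i, rfl⟩
    rw [hone i]
    exact iff_of_true hadj.symm hac.symm
  · obtain ⟨i, rfl⟩ : x ∈ Set.range D.p := hx ▸ Set.mem_singleton x
    rw [hone i]
    exact ⟨hadj.symm, hac.symm⟩

theorem Twins.isListed_single (D : PathPair G) (hk : D.k = 1) {a : Fin D.k}
    {b : Fin D.j} (h : Twins G (D.p a) (D.q b)) (hiso : ∀ v, ∃ w, G.Adj v w)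
    (hfort : ∀ x, ∃ W, IsFort G W ∧ x ∉ W) :
    IsListed G (Set.range D.p) (Set.range D.q) ∨ IsListed G (Set.range D.q) (Set.range D.p) := by
  have hone : ∀ i : Fin D.k, i = a := fun i => Fin.ext (by omega)
  have hb := b.isLt
  rcases Nat.lt_or_ge 2 D.j with hj | hj
  · exact Or.inl (Or.inl (h.formA_of_single D hk hj))
  obtain ⟨W, hW, haW⟩ := hfort (D.p a)
  obtain ⟨w, hw⟩ := hW.1
  rcases Nat.lt_or_ge 1 D.j with hj' | hj'
  · by_cases hadj : G.Adj (D.p a) (D.q b)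
    · exact Or.inr (Or.inr (Or.inl (h.formB_of_triangle D hk (by omega) hadj)))
    -- Here `G` is P_3 with the twins as its ends; a fort avoiding one end does not exist.
    exfalso
    obtain ⟨c, hc⟩ : ∃ c : Fin D.j, b.val + 1 = c.val ∨ c.val + 1 = b.val := by
      rcases Nat.eq_zero_or_pos b.val with h0 | h0
      · exact ⟨⟨1, by omega⟩, Or.inl (by simp; omega)⟩
      · exact ⟨⟨b.val - 1, by omega⟩, Or.inr (by simp; omega)⟩
    have hcases : ∀ x, x = D.p a ∨ x = D.q b ∨ x = D.q c := fun x => by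
      rcases D.mem_or_mem x with ⟨i, rfl⟩ | ⟨l, rfl⟩
      · exact Or.inl (congrArg D.p (hone i))
      · refine Or.inr ?_
        have : l = b ∨ l = c := by
          simp only [Fin.ext_iff]
          omega
        rcases this with rfl | rfl
        · exact Or.inl rfl
        · exact Or.inr rfl
    have hcW : D.q c ∉ W := fun hcW => by
      obtain ⟨x, hx, hxc, hax⟩ := hW.2 _ haW _ hcW (h.adj_cross D hc)
      rcases hcases x with rfl | rfl | rfl
      · exact haW hx
      · exact hadj hax
      · exact hxc rfl
    have hbW : D.q b ∈ W := by
      rcases hcases w with rfl | rfl | rfl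
      · exact absurd hw haW
      · exact hw
      · exact absurd hw hcW
    obtain ⟨x, hx, hxb, -⟩ := hW.2 _ hcW _ hbW (D.adj_q.mpr hc.symm)
    rcases hcases x with rfl | rfl | rfl
    · exact haW hx
    · exact hxb rfl
    · exact hcW hx
  · exfalso
    have hcases : ∀ x, x = D.p a ∨ x = D.q b := fun x => by
      rcases D.mem_or_mem x with ⟨i, rfl⟩ | ⟨l, rfl⟩
      · exact Or.inl (congrArg D.p (hone i))
      · exact Or.inr (congrArg D.q (Fin.ext (by omega)))
    have hbW : D.q b ∈ W := by
      rcases hcases w with rfl | rfl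
      · exact absurd hw haW
      · exact hw
    obtain ⟨y, hy⟩ := hiso (D.p a)
    rcases hcases y with rfl | rfl
    · exact G.loopless.irrefl _ hy
    obtain ⟨x, hx, hxb, -⟩ := hW.2 _ haW _ hbW hy
    rcases hcases x with rfl | rfl
    · exact haW hx
    · exact hxb rfl

/-- Each twin is adjacent to the path neighbors of the other. If both had a predecessor, or both a
successor, two of these edges would cross; so `a` is last and `b` is first on its path. -/
theorem Twins.formD (D : PathPair G) {a : Fin D.k} {b : Fin D.j} (h : Twins G (D.p a) (D.q b))
    (ha : 0 < a.val) (hj : 2 ≤ D.j) : FormD G (Set.range D.p) (Set.range D.q) := by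
  have hpq : ∀ {i : Fin D.k}, (a.val + 1 = i.val ∨ i.val + 1 = a.val) → G.Adj (D.p i) (D.q b) :=
    fun hi => (Twins.adj_cross D.swap h.symm hi).symm
  have hqp : ∀ {i : Fin D.k}, G.Adj (D.p i) (D.q b) →
      i = a ∨ a.val + 1 = i.val ∨ i.val + 1 = a.val :=
    fun hi => Twins.eq_or_of_adj_cross D.swap h.symm hi.symm
  have ha' := a.isLt
  have hb' := b.isLt
  obtain ⟨c, hc⟩ : ∃ c : Fin D.k, c.val + 1 = a.val := ⟨⟨a.val - 1, by omega⟩, by simp; omega⟩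
  have hcb := hpq (Or.inr hc)
  have hca : c < a := Fin.lt_def.mpr (by omega)
  have hb0 : b.val = 0 := by
    by_contra hne
    obtain ⟨d, hd⟩ : ∃ d : Fin D.j, d.val + 1 = b.val := ⟨⟨b.val - 1, by omega⟩, by simp; omega⟩
    have := Fin.le_def.mp (D.noncrossing hcb (h.adj_cross D (Or.inr hd)) hca)
    omega
  obtain ⟨d, hd⟩ : ∃ d : Fin D.j, b.val + 1 = d.val := ⟨⟨b.val + 1, by omega⟩, rfl⟩
  have had := h.adj_cross D (Or.inl hd)
  have hak : a.val + 1 = D.k := by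
    by_contra hne
    obtain ⟨e, he⟩ : ∃ e : Fin D.k, a.val + 1 = e.val := ⟨⟨a.val + 1, by omega⟩, rfl⟩
    have := Fin.le_def.mp (D.noncrossing had (hpq (Or.inl he)) (Fin.lt_def.mpr (by omega)))
    omega
  -- By noncrossing, a vertex before `c` could only reach `b`, whose neighbors on the first path are
  -- already known; the edge from `a` to `d` stops `c` from reaching beyond `d`.
  have hedge : ∀ {i l}, G.Adj (D.p i) (D.q l) → (i = c ∨ i = a) ∧ (l = b ∨ l = d) := by
    intro i l hil
    have hi := i.isLt
    have hic : ¬ i.val < c.val := fun hlt => by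
      have hl := Fin.le_def.mp (D.noncrossing hil hcb (Fin.lt_def.mpr hlt))
      obtain rfl : l = b := Fin.ext (by omega)
      have := hqp hil
      simp only [Fin.ext_iff] at this
      omega
    have hi2 : i = c ∨ i = a := by
      simp only [Fin.ext_iff]
      omega
    refine ⟨hi2, ?_⟩
    rcases hi2 with rfl | rfl
    · have hl := Fin.le_def.mp (D.noncrossing hil had hca)
      simp only [Fin.ext_iff]
      omega
    · have := h.eq_or_of_adj_cross D hil
      simp only [Fin.ext_iff] at this ⊢
      omega
  -- The two optional edges are the diagonals of a quadrilateral, so at most one is present.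
  have hnot : ¬ (G.Adj (D.p c) (D.q d) ∧ G.Adj (D.p a) (D.q b)) := fun ⟨h1, h2⟩ => by
    have := Fin.le_def.mp (D.noncrossing h1 h2 hca)
    omega
  have hset : ∀ x y, (x, y) ∈ edgesBetween G (Set.range D.p) (Set.range D.q) ↔
      (x = D.p c ∧ y = D.q b) ∨ (x = D.p a ∧ y = D.q d) ∨
      (x = D.p c ∧ y = D.q d ∧ G.Adj (D.p c) (D.q d)) ∨
      (x = D.p a ∧ y = D.q b ∧ G.Adj (D.p a) (D.q b)) := by
    intro x y
    constructor
    · rintro ⟨⟨i, rfl⟩, ⟨l, rfl⟩, hil⟩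
      obtain ⟨rfl | rfl, rfl | rfl⟩ := hedge hil
      · exact Or.inl ⟨rfl, rfl⟩
      · exact Or.inr (Or.inr (Or.inl ⟨rfl, rfl, hil⟩))
      · exact Or.inr (Or.inr (Or.inr ⟨rfl, rfl, hil⟩))
      · exact Or.inr (Or.inl ⟨rfl, rfl⟩)
    · rintro (⟨rfl, rfl⟩ | ⟨rfl, rfl⟩ | ⟨rfl, rfl, h'⟩ | ⟨rfl, rfl, h'⟩)
      · exact ⟨⟨c, rfl⟩, ⟨b, rfl⟩, hcb⟩
      · exact ⟨⟨a, rfl⟩, ⟨d, rfl⟩, had⟩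
      · exact ⟨⟨c, rfl⟩, ⟨d, rfl⟩, h'⟩
      · exact ⟨⟨a, rfl⟩, ⟨b, rfl⟩, h'⟩
  -- The geometric facts are now contained in `hset` and `hnot`; dropping the rest lets the pair be
  -- taken apart and its lengths rewritten as m + 2 and l + 2.
  clear hedge hpq hqp hcb had h
  obtain ⟨k, j, _, _, p, q, _, _⟩ := D
  obtain ⟨m, rfl⟩ : ∃ m, k = m + 2 := ⟨k - 2, by dsimp only at *; omega⟩
  obtain ⟨l, rfl⟩ : ∃ l, j = l + 2 := ⟨j - 2, by dsimp only at *; omega⟩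
  dsimp only at *
  refine ⟨m, l, p, q, rfl, rfl, p c, p a, q b, q d, congrArg p (Fin.ext ?_),
    congrArg p (Fin.ext ?_), congrArg q (Fin.ext ?_), congrArg q (Fin.ext ?_), ?_⟩
  · simp only
    omega
  · simp only
    omega
  · simp only
    omega
  · simp only
    omega
  by_cases h1 : G.Adj (p c) (q d)
  · right; left
    have h2 : ¬ G.Adj (p a) (q b) := fun h2 => hnot ⟨h1, h2⟩
    ext ⟨x, y⟩
    rw [hset]
    simp [h1, h2]
  · by_cases h2 : G.Adj (p a) (q b)
    · right; right
      ext ⟨x, y⟩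
      rw [hset]
      simp [h1, h2]
    · left
      ext ⟨x, y⟩
      rw [hset]
      simp [h1, h2]

/-- When both paths have at least two vertices, the twins cannot both be first on their paths, since
the edges to each other's successors would cross. Some twin thus has a predecessor, and its path
takes the first role in form D. -/
theorem Twins.isListed_cross (D : PathPair G) {a : Fin D.k} {b : Fin D.j}
    (h : Twins G (D.p a) (D.q b)) (hiso : ∀ v, ∃ w, G.Adj v w)
    (hfort : ∀ x, ∃ W, IsFort G W ∧ x ∉ W) :
    IsListed G (Set.range D.p) (Set.range D.q) ∨ IsListed G (Set.range D.q) (Set.range D.p) := by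
  have hk := D.k_pos
  have hj := D.j_pos
  by_cases hk1 : D.k = 1
  · exact h.isListed_single D hk1 hiso hfort
  by_cases hj1 : D.j = 1
  · exact (Twins.isListed_single D.swap hj1 h.symm hiso hfort).symm
  rcases Nat.eq_zero_or_pos a.val with ha | ha
  · rcases Nat.eq_zero_or_pos b.val with hb | hb
    · obtain ⟨c, hc⟩ : ∃ c : Fin D.k, a.val + 1 = c.val := ⟨⟨a.val + 1, by omega⟩, rfl⟩
      obtain ⟨d, hd⟩ : ∃ d : Fin D.j, b.val + 1 = d.val := ⟨⟨b.val + 1, by omega⟩, rfl⟩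
      have := Fin.le_def.mp (D.noncrossing (h.adj_cross D (Or.inl hd))
        (Twins.adj_cross D.swap h.symm (Or.inl hc)).symm (Fin.lt_def.mpr (by omega)))
      omega
    · exact Or.inr (Or.inr (Or.inr (Or.inr (Twins.formD D.swap h.symm hb
        (show 2 ≤ D.k by omega)))))
  · exact Or.inl (Or.inr (Or.inr (Or.inr (h.formD D ha (by omega)))))

theorem Twins.isListed (D : PathPair G) {u v : V} (h : Twins G u v)
    (hiso : ∀ v, ∃ w, G.Adj v w) (hfort : ∀ x, ∃ W, IsFort G W ∧ x ∉ W) :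
    IsListed G (Set.range D.p) (Set.range D.q) ∨ IsListed G (Set.range D.q) (Set.range D.p) := by
  rcases D.mem_or_mem u with ⟨a, rfl⟩ | ⟨a, rfl⟩ <;> rcases D.mem_or_mem v with ⟨b, rfl⟩ | ⟨b, rfl⟩
  · exact Or.inl (h.isListed_same D hiso)
  · exact h.isListed_cross D hiso hfort
  · exact h.symm.isListed_cross D hiso hfort
  · exact Or.inr (Twins.isListed_same D.swap h hiso)

end TwinsToForms

/-! ### From the listed forms back to twins -/

section FormsToTwins

variable {V : Type*} {G : SimpleGraph V}

theorem exists_adj_of_mem_range {n : ℕ} (f : SimpleGraph.pathGraph n ↪g G) (hn : 2 ≤ n) {x : V}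
    (hx : x ∈ Set.range f) : ∃ y, G.Adj x y := by
  obtain ⟨i, rfl⟩ := hx
  have hi := i.isLt
  rcases Nat.eq_zero_or_pos i.val with h | h
  · refine ⟨f ⟨1, by omega⟩, f.map_adj_iff.mpr (SimpleGraph.pathGraph_adj.mpr (Or.inl ?_))⟩
    simp only
    omega
  · refine ⟨f ⟨i.val - 1, by omega⟩, f.map_adj_iff.mpr (SimpleGraph.pathGraph_adj.mpr (Or.inr ?_))⟩
    simp only
    omega

theorem two_le_of_range {n : ℕ} (f : SimpleGraph.pathGraph n ↪g G) {x y : V}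
    (hx : x ∈ Set.range f) (hy : y ∈ Set.range f) (hxy : x ≠ y) : 2 ≤ n := by
  obtain ⟨i, rfl⟩ := hx
  obtain ⟨l, rfl⟩ := hy
  have : i.val ≠ l.val := fun h => hxy (congrArg f (Fin.ext h))
  omega

theorem PathPair.exists_adj (D : PathPair G) (hp : ∀ x ∈ Set.range D.p, ∃ y, G.Adj x y)
    (hq : ∀ x ∈ Set.range D.q, ∃ y, G.Adj x y) (v : V) : ∃ w, G.Adj v w := by
  rcases D.mem_or_mem v with h | h
  · exact hp v h
  · exact hq v h

theorem PathPair.exists_adj_of_singleton (D : PathPair G)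
    (h : ∀ x, Set.range D.q = {x} → ∃ y, G.Adj x y) :
    ∀ x ∈ Set.range D.q, ∃ y, G.Adj x y := by
  intro x hx
  by_cases hj : 2 ≤ D.j
  · exact exists_adj_of_mem_range D.q hj hx
  · refine h x (Set.eq_singleton_iff_unique_mem.mpr ⟨hx, fun y hy => ?_⟩)
    by_contra hne
    exact hj (two_le_of_range D.q hy hx hne)

/-- The twin of the single vertex is the middle vertex of the subpath, or the end vertex of the
path. -/
theorem FormA.twins (D : PathPair G) (h : FormA G (Set.range D.p) (Set.range D.q)) :
    (∃ u v, Twins G u v) ∧ ∀ v, ∃ w, G.Adj v w := by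
  obtain ⟨x, hx, hcard, h⟩ := h
  have hj : 2 ≤ D.j := by
    rw [← Set.image_univ, Set.ncard_image_of_injective _ D.q.injective, Set.ncard_univ,
      Nat.card_fin] at hcard
    omega
  have hxq : ∀ l, D.q l ≠ x := fun l he => by
    obtain ⟨i, hi⟩ : x ∈ Set.range D.p := hx ▸ Set.mem_singleton x
    exact D.p_ne_q i l (hi.trans he.symm)
  have hmem : ∀ y, y ≠ x → ∃ l, D.q l = y := fun y hy => by
    rcases D.mem_or_mem y with hy' | hy'
    · have : y ∈ Set.range D.p := hy'
      rw [hx] at this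
      exact absurd this hy
    · exact hy'
  have hiso : (∃ y, G.Adj x y) → ∀ v, ∃ w, G.Adj v w := fun hxy =>
    D.exists_adj (fun y hy => by rw [hx] at hy; exact hy ▸ hxy)
      fun y hy => exists_adj_of_mem_range D.q hj hy
  rcases h with ⟨_, ⟨a, rfl⟩, _, ⟨b, rfl⟩, _, ⟨c, rfl⟩, hac, hab, hbc, hN⟩ |
    ⟨_, ⟨b, rfl⟩, _, ⟨c, rfl⟩, hb, hN⟩
  · have hxy : ∀ y, y ≠ D.q b → (G.Adj x y ↔ y = D.q a ∨ y = D.q c) := fun y hy => by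
      rw [← SimpleGraph.mem_neighborSet]
      rcases hN with hN | hN <;> rw [hN] <;> simp [hy]
    refine ⟨⟨x, D.q b, (hxq b).symm, fun y hyx hyb => ?_⟩,
      hiso ⟨D.q a, (hxy _ hab.ne).mpr (Or.inl rfl)⟩⟩
    rw [hxy y hyb]
    constructor
    · rintro (rfl | rfl)
      · exact hab.symm
      · exact hbc
    · intro hby
      obtain ⟨l, rfl⟩ := hmem y hyx
      rw [D.adj_q] at hab hbc hby
      have hac' : a.val ≠ c.val := fun he => hac (congrArg D.q (Fin.ext he))
      have : l.val = a.val ∨ l.val = c.val := by omega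
      exact this.imp (fun h => congrArg D.q (Fin.ext h)) (fun h => congrArg D.q (Fin.ext h))
  · have hby : ∀ l, G.Adj (D.q b) (D.q l) ↔ D.q l = D.q c := fun l => by
      have := Set.ext_iff.mp hb (D.q l)
      rwa [Set.mem_inter_iff, and_iff_left ⟨l, rfl⟩] at this
    have hbc := (hby c).mpr rfl
    have hxy : ∀ y, y ≠ D.q b → (G.Adj x y ↔ y = D.q c) := fun y hy => by
      rw [← SimpleGraph.mem_neighborSet]
      rcases hN with hN | hN <;> rw [hN] <;> simp [hy]
    refine ⟨⟨x, D.q b, (hxq b).symm, fun y hyx hyb => ?_⟩, hiso ⟨D.q c, (hxy _ hbc.ne').mpr rfl⟩⟩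
    obtain ⟨l, rfl⟩ := hmem y hyx
    rw [hxy _ hyb, hby]

theorem FormB.twins (D : PathPair G) (h : FormB G (Set.range D.p) (Set.range D.q)) :
    (∃ u v, Twins G u v) ∧ ∀ v, ∃ w, G.Adj v w := by
  obtain ⟨u, v, hp, huv, hN, hx⟩ := h
  refine ⟨⟨u, v, huv.ne, fun x hxu hxv => ?_⟩, D.exists_adj (fun x hx => ?_)
    (D.exists_adj_of_singleton fun x h => ⟨u, (hx x h).1.symm⟩)⟩
  · rcases D.mem_or_mem x with h | h
    · have : x ∈ Set.range D.p := h
      rw [hp] at this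
      rcases this with rfl | rfl
      · exact absurd rfl hxu
      · exact absurd rfl hxv
    · have h' : x ∈ Set.range D.q := h
      have := Set.ext_iff.mp hN x
      rwa [Set.mem_inter_iff, Set.mem_inter_iff, and_iff_left h', and_iff_left h'] at this
  · rw [hp] at hx
    rcases hx with rfl | rfl
    · exact ⟨_, huv⟩
    · exact ⟨_, huv.symm⟩

theorem FormC.twins (D : PathPair G) (h : FormC G (Set.range D.p) (Set.range D.q)) :
    (∃ u v, Twins G u v) ∧ ∀ v, ∃ w, G.Adj v w := by
  obtain ⟨u, v, w, hp, huw, huv, hvw, hN, hx⟩ := h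
  have hN' : G.neighborSet u = G.neighborSet w := by
    rcases hN with ⟨h1, h2⟩ | ⟨x, -, h1, h2⟩ <;> rw [h1, h2]
  refine ⟨⟨u, w, huw, fun x _ _ => Set.ext_iff.mp hN' x⟩, D.exists_adj (fun x hx => ?_)
    (D.exists_adj_of_singleton hx)⟩
  rw [hp] at hx
  rcases hx with rfl | rfl | rfl
  · exact ⟨_, huv⟩
  · exact ⟨_, hvw⟩
  · exact ⟨_, hvw.symm⟩

/-- The twins are the last vertex of the first path and the first vertex of the second: each sees
v_{k-1} and w_2, and the optional edges do not change this. -/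
theorem FormD.twins (D : PathPair G) (h : FormD G (Set.range D.p) (Set.range D.q)) :
    (∃ u v, Twins G u v) ∧ ∀ v, ∃ w, G.Adj v w := by
  obtain ⟨m, l, p, q, hp, hq, v', v, w₁, w₂, hv', hv, hw₁, hw₂, hE⟩ := h
  have hne : ∀ i i', p i ≠ q i' := fun i i' he => by
    have h1 : p i ∈ Set.range D.p := hp ▸ ⟨i, rfl⟩
    have h2 : p i ∈ Set.range D.q := hq ▸ ⟨i', he.symm⟩
    exact Set.disjoint_left.mp D.partition.disjoint h1 h2
  have hadj : ∀ i i', G.Adj (p i) (q i') ↔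
      (p i, q i') ∈ edgesBetween G (Set.range D.p) (Set.range D.q) := fun i i' =>
    ⟨fun h => ⟨hp ▸ ⟨i, rfl⟩, hq ▸ ⟨i', rfl⟩, h⟩, fun h => h.2.2⟩
  have hvq : ∀ i, q i ≠ w₁ → (G.Adj v (q i) ↔ q i = w₂) := by
    intro i hi
    have hvv : v ≠ v' := by
      rw [hv, hv']
      exact fun he => by simpa using congrArg Fin.val (p.injective he)
    rw [hv, hadj, ← hv]
    rcases hE with hE | hE | hE <;> rw [hE] <;> simp [hvv, hi]
  have hwp : ∀ i, p i ≠ v → (G.Adj w₁ (p i) ↔ p i = v') := by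
    intro i hi
    have hww : w₁ ≠ w₂ := by
      rw [hw₁, hw₂]
      exact fun he => by simpa using congrArg Fin.val (q.injective he)
    rw [G.adj_comm, hw₁, hadj, ← hw₁]
    rcases hE with hE | hE | hE <;> rw [hE] <;> simp [hww, hi]
  have hvp : ∀ i, G.Adj v (p i) ↔ p i = v' := by
    intro i
    rw [hv, hv', p.map_adj_iff, SimpleGraph.pathGraph_adj, p.injective.eq_iff, Fin.ext_iff]
    have := i.isLt
    simp only
    omega
  have hwq : ∀ i, G.Adj w₁ (q i) ↔ q i = w₂ := by
    intro i
    rw [hw₁, hw₂, q.map_adj_iff, SimpleGraph.pathGraph_adj, q.injective.eq_iff, Fin.ext_iff]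
    simp only
    omega
  refine ⟨⟨v, w₁, ?_, fun x hxv hxw => ?_⟩,
    D.exists_adj (fun x hx => exists_adj_of_mem_range p (by omega) (hp ▸ hx))
      fun x hx => exists_adj_of_mem_range q (by omega) (hq ▸ hx)⟩
  · rw [hv, hw₁]
    exact hne _ _
  · have hx : x ∈ Set.range p ∨ x ∈ Set.range q := by
      rw [hp, hq]
      exact D.mem_or_mem x
    rcases hx with ⟨i, rfl⟩ | ⟨i, rfl⟩
    · rw [hvp, hwp i hxv]
    · rw [hwq, hvq i hxw]

theorem IsListed.twins (D : PathPair G) (h : IsListed G (Set.range D.p) (Set.range D.q)) :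
    (∃ u v, Twins G u v) ∧ ∀ v, ∃ w, G.Adj v w := by
  rcases h with h | h | h | h
  · exact h.twins D
  · exact h.twins D
  · exact h.twins D
  · exact h.twins D

/-- The fort number does not depend on the drawing, so one drawing of a listed form suffices to
produce twins, and twins put every drawing into a listed form. -/
theorem forall_hasListedForm_iff [Fintype V] [DecidableEq V] [Nonempty V]
    (hz : zeroForcingNumber G = 2) :
    (∀ D : StandardDrawing G, D.HasListedForm) ↔ fortNumber G = 2 := by
  rw [fortNumber_eq_two_iff]
  constructor
  · intro h
    obtain ⟨D⟩ := nonempty_pathPair_of_zeroForcingNumber hz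
    rcases h D.toStandardDrawing with h | h
    · exact h.twins D
    · exact IsListed.twins D.swap h
  · rintro ⟨⟨u, v, huv⟩, hiso⟩ D
    exact huv.isListed D.toPathPair hiso (exists_isFort_notMem hz)

end FormsToTwins

end ZeroForcingSpan

/-! ### The three ways of writing 4 as a sum of the two numbers -/

theorem mainTheorem1 {V : Type*} [Fintype V] [DecidableEq V] (G : SimpleGraph V) :
    (ZeroForcingSpan.span G : ℤ) = (Fintype.card V : ℤ) - 3 ↔
      (∃ v : V, (∀ w, ¬ G.Adj v w) ∧ ZeroForcingSpan.TwoParallelPaths (G.induce {v}ᶜ)) ∨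
      (ZeroForcingSpan.IsPathOn G 4 ∨ ZeroForcingSpan.IsPathOn G 5) ∨
      (ZeroForcingSpan.TwoParallelPaths G ∧
        ∀ D : ZeroForcingSpan.StandardDrawing G, D.HasListedForm) := by
  open ZeroForcingSpan in
  rcases isEmpty_or_nonempty V with hV | hV
  -- For the empty graph the integer n - 3 is negative, and none of the listed graphs is empty.
  · rw [Fintype.card_eq_zero]
    refine iff_of_false (by omega) ?_
    rintro (⟨v, -⟩ | (h | h) | ⟨⟨-, ⟨D⟩⟩, -⟩)
    · exact hV.elim v
    · exact absurd h.card_eq (by simp)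
    · exact absurd h.card_eq (by simp)
    · exact hV.elim (D.p ⟨0, D.k_pos⟩)
  have hspan := span_add_eq (G := G)
  have hz := one_le_zeroForcingNumber (G := G)
  have hf := one_le_fortNumber (G := G)
  have hiff : (span G : ℤ) = (Fintype.card V : ℤ) - 3 ↔
      fortNumber G + zeroForcingNumber G = 4 := by omega
  rw [hiff]
  constructor
  · intro h
    have hcases : (fortNumber G = 1 ∧ zeroForcingNumber G = 3) ∨
        (fortNumber G = 3 ∧ zeroForcingNumber G = 1) ∨
        (fortNumber G = 2 ∧ zeroForcingNumber G = 2) := by omega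
    rcases hcases with ⟨h1, h2⟩ | ⟨h1, h2⟩ | ⟨h1, h2⟩
    · obtain ⟨v, hv⟩ := fortNumber_eq_one_iff.mp h1
      have := zeroForcingNumber_eq_add_one hv
      exact Or.inl ⟨v, hv, twoParallelPaths_iff.mpr (by omega)⟩
    · obtain ⟨n, hn⟩ := exists_isPathOn_of_zeroForcingNumber h2
      rcases hn.eq_of_fortNumber h1 with rfl | rfl
      · exact Or.inr (Or.inl (Or.inl hn))
      · exact Or.inr (Or.inl (Or.inr hn))
    · exact Or.inr (Or.inr ⟨twoParallelPaths_iff.mpr h2, (forall_hasListedForm_iff h2).mpr h1⟩)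
  · rintro (⟨v, hv, h⟩ | (h | h) | ⟨h, hD⟩)
    · have h1 := fortNumber_eq_one_iff.mpr ⟨v, hv⟩
      have h2 := zeroForcingNumber_eq_add_one hv
      have h3 := twoParallelPaths_iff.mp h
      omega
    · rw [h.fortNumber_eq_four, h.zeroForcingNumber_eq]
    · rw [h.fortNumber_eq_five, h.zeroForcingNumber_eq]
    · have h2 := twoParallelPaths_iff.mp h
      have h1 := (forall_hasListedForm_iff h2).mp hD
      omega
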